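/- Let $n\ge 1$ and $s\in\mathbb{R}$. With $\widehat f(\xi)=(2\pi)^{-n/2}\int_{\mathbb{R}^n}e^{-i\langle x,\xi\rangle}f(x)\,dx$ (extended unitarily to $L^2$), put $$\|f\|_{H^s}=\Big(\int_{\mathbb{R}^n}(1+|\xi|^2)^s|\widehat f(\xi)|^2\,d\xi\Big)^{1/2},\qquad e^{it\Delta}f(x)=(2\pi)^{-n/2}\int_{\mathbb{R}^n}e^{i(\langle x,\xi\rangle+t|\xi|^2)}\widehat f(\xi)\,d\xi$$ for Schwartz $f$; for $f\in L^2(\mathbb{R}^n)$, let $e^{it\Delta}f\in L^2(\mathbb{R}^n)$ be the function with Fourier transform $e^{it|\xi|^2}\widehat f(\xi)$. Consider the following two properties. (A) For every $f\in L^2(\mathbb{R}^n)$ with $\|f\|_{H^s}<\infty$ (for $s\ge0$: every $f\in H^s(\mathbb{R}^n)$), $e^{it\Delta}f(x)\to f(x)$ as $t\to0^+$ for a.e. $x\in\mathbb{R}^n$; that is, there is a function $u(x,t)$ such that $u(\cdot,t)=e^{it\Delta}f$ a.e. for each $0<t<1$, and $\lim_{t\to0^+}u(x,t)=f(x)$ for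 a.e. $x$. (B) The Schrödinger maximal operator is bounded from $H^s(\mathbb{R}^n)$ to $L^{2,\infty}(B(0,1))$: there is a constant $C<\infty$ such that for all Schwartz functions $f$ on $\mathbb{R}^n$, $$\sup_{r>0}\, r\,\Big|\Big\{x\in B(0,1):\ \sup_{0<t<1}|e^{it\Delta}f(x)|>r\Big\}\Big|^{1/2}\le C\,\|f\|_{H^s}.$$ Then (A) and (B) are equivalent, and each of them implies $$s\ \ge\ \frac{n}{2(n+1)}.$$ -/

import Mathlib

open MeasureTheory Filter Topology FourierTransform
open scoped ENNReal NNReal SchwartzMap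

noncomputable section

namespace SchrodingerMaximal

/-- The Fourier symbol of `e^{itΔ}` (the propagator of `i ∂ₜ u - Δ u = 0`). Mathlib's Fourier
transform is `𝓕 f ξ = ∫ e^{-2πi⟨x,ξ⟩} f(x) dx`, so the angular frequency is `2πξ` and the symbol
is `e^{it|2πξ|²}`. -/
def symbol {n : ℕ} (t : ℝ) (ξ : EuclideanSpace ℝ (Fin n)) : ℂ :=
  Complex.exp (Complex.I * ((t * (2 * Real.pi * ‖ξ‖) ^ 2 : ℝ) : ℂ))

/-- The Schrödinger solution at time `t` and point `x` for Schwartz initial data: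
`e^{itΔ} f(x) = ∫ e^{i(⟨x, 2πξ⟩ + t|2πξ|²)} 𝓕 f(ξ) dξ`. With the angular frequency `η = 2πξ` and
the unitary normalization of the Fourier transform this is
`(2π)^{-n/2} ∫ e^{i(⟨x, η⟩ + t|η|²)} f^(η) dη`. -/
def evolution {n : ℕ} (t : ℝ) (f : 𝓢(EuclideanSpace ℝ (Fin n), ℂ))
    (x : EuclideanSpace ℝ (Fin n)) : ℂ :=
  ∫ ξ : EuclideanSpace ℝ (Fin n),
    Complex.exp (Complex.I * ((2 * Real.pi * inner ℝ x ξ : ℝ) : ℂ)) * symbol t ξ * 𝓕 f ξ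

lemma norm_symbol {n : ℕ} (t : ℝ) (ξ : EuclideanSpace ℝ (Fin n)) : ‖symbol t ξ‖ = 1 := by
  rw [symbol, mul_comm]
  exact Complex.norm_exp_ofReal_mul_I _

lemma continuous_symbol {n : ℕ} (t : ℝ) :
    Continuous (symbol t : EuclideanSpace ℝ (Fin n) → ℂ) := by
  unfold symbol
  fun_prop

lemma memLp_symbol_mul {n : ℕ} (t : ℝ) (g : Lp (α := EuclideanSpace ℝ (Fin n)) ℂ 2) :
    MemLp (fun ξ => symbol t ξ * g ξ) 2 := by
  refine (Lp.memLp g).of_le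
    ((continuous_symbol t).aestronglyMeasurable.mul (Lp.aestronglyMeasurable g))
    (Eventually.of_forall fun ξ => ?_)
  rw [norm_mul, norm_symbol, one_mul]

/-- `e^{itΔ} f` for `f ∈ L²(ℝⁿ)`, as an element of `L²(ℝⁿ)`: the function whose (Plancherel) Fourier
transform is `e^{it|2πξ|²} 𝓕 f(ξ)`. -/
def evolutionL2 {n : ℕ} (t : ℝ) (f : Lp (α := EuclideanSpace ℝ (Fin n)) ℂ 2) :
    Lp (α := EuclideanSpace ℝ (Fin n)) ℂ 2 :=
  𝓕⁻ ((memLp_symbol_mul t (𝓕 f)).toLp)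

/-- The Sobolev norm `‖f‖_{H^s} = (∫ (1 + |2πξ|²)^s |𝓕 f(ξ)|² dξ)^{1/2}`, possibly infinite. -/
def sobolevNorm {n : ℕ} (s : ℝ) (f : Lp (α := EuclideanSpace ℝ (Fin n)) ℂ 2) : ℝ≥0∞ :=
  (∫⁻ ξ : EuclideanSpace ℝ (Fin n),
    ENNReal.ofReal ((1 + (2 * Real.pi * ‖ξ‖) ^ 2) ^ s) * ‖(𝓕 f) ξ‖ₑ ^ 2) ^ (1 / 2 : ℝ)

/-- The Schrödinger maximal function `x ↦ sup_{0 < t < 1} |e^{itΔ} f(x)|`. -/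
def maximalFunction {n : ℕ} (f : 𝓢(EuclideanSpace ℝ (Fin n), ℂ))
    (x : EuclideanSpace ℝ (Fin n)) : ℝ≥0∞ :=
  ⨆ t ∈ Set.Ioo (0 : ℝ) 1, ‖evolution t f x‖ₑ

/-- The weak `L²` (quasi-)norm `‖g‖_{L^{2,∞}(μ)} = sup_{r ≥ 0} r μ{g > r}^{1/2}`. -/
def weakL2Norm {α : Type*} [MeasurableSpace α] (g : α → ℝ≥0∞) (μ : Measure α) : ℝ≥0∞ :=
  ⨆ r : ℝ≥0, (r : ℝ≥0∞) * μ {x | (r : ℝ≥0∞) < g x} ^ (1 / 2 : ℝ)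

/-- The maximal operator is bounded from `H^s(ℝⁿ)` to `L^{2,∞}(B(0,1))`: the estimate holds with a
uniform constant on the dense class of Schwartz functions. -/
def MaximalBounded (n : ℕ) (s : ℝ) : Prop :=
  ∃ C : ℝ≥0, ∀ f : 𝓢(EuclideanSpace ℝ (Fin n), ℂ),
    weakL2Norm (maximalFunction f) (volume.restrict (Metric.ball 0 1)) ≤
      C * sobolevNorm s (f.toLp 2)

/-- `e^{itΔ} f(x) → f(x)` as `t → 0⁺`, for almost every `x`. For each `t` the function `e^{itΔ} f`
is only an `L²` class, so the statement is about a choice `u(·, t)` of representatives. -/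
def ConvergesAE {n : ℕ} (f : Lp (α := EuclideanSpace ℝ (Fin n)) ℂ 2) : Prop :=
  ∃ u : EuclideanSpace ℝ (Fin n) → ℝ → ℂ,
    (∀ t ∈ Set.Ioo (0 : ℝ) 1, (fun x => u x t) =ᵐ[volume] evolutionL2 t f) ∧
    ∀ᵐ x, Tendsto (u x) (𝓝[>] 0) (𝓝 (f x))

/-- Almost everywhere convergence to the initial data for every `f ∈ L²` with finite `H^s` norm;
for `s ≥ 0` this is every `f ∈ H^s(ℝⁿ)`. -/
def ConvergesAEOnSobolev (n : ℕ) (s : ℝ) : Prop :=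
  ∀ f : Lp (α := EuclideanSpace ℝ (Fin n)) ℂ 2, sobolevNorm s f < ∞ → ConvergesAE f

end SchrodingerMaximal

end

noncomputable section

namespace SchrodingerMaximal

/-! ### Multipliers of temperate growth -/

/-! For `s ≥ 0` the equivalence is Stein's maximal principle together with its standard converse.
Almost everywhere convergence makes `e^{itΔ} f(x)` bounded for small rational `t` at almost every
`x`. Baire's theorem in `L²`, used as a model of `H^s`, turns this into a uniform statement: on a
fixed time interval `(0, δ)`, data of norm at most `A` have maximal function above 1 only on a small
part of the unit ball (`exists_measure_exceedSet_le`). Translations commute with the flow and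
preserve the `H^s` norm. So if the set `F` where the maximal function of `f` exceeds 1 were too
large for `‖f‖`, about `1/|F|` translates of `F` would cover half of the ball, and a randomly signed
sum of the translates of `f` would contradict the uniform statement (`volume_real_sq_le_of_small`).
Scaling and the group law then give the weak-type bound on `(0, 1)`.

Conversely, the weak-type bound and Borel–Cantelli make a rapidly convergent Schwartz approximation
converge uniformly in `t ∈ [0, 1)` at almost every `x`, and the limit is continuous at `t = 0`.

For the exponent put `n = d + 1` and let `f` have as Fourier transform a sum of `N = p^{2d+2}`
disjoint bumps of fixed radius at frequencies of size about `p^{2d+4}`. They sit on a lattice for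
which each `x` in a half ball admits a time `t` aligning all phases up to `1/6` of a period
(`exists_time_aligned`). Then `|e^{itΔ} f| ≳ N` on the half ball while `‖f‖_{H^s}² ≲ p^{(4d+8)s} N`.
The maximal estimate forces `p^{2d+2} ≲ p^{(4d+8)s}` for all `p`, which is `s ≥ n / (2(n+1))`.
Negative `s` reduces to `max s 0`, because both properties persist when `s` grows. -/

lemma iteratedDeriv_cexp_I_mul (k : ℕ) (r : ℝ) :
    iteratedDeriv k (fun r : ℝ => Complex.exp (Complex.I * r)) r =
      Complex.I ^ k * Complex.exp (Complex.I * r) := by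
  induction k generalizing r with
  | zero => simp
  | succ k ih =>
    rw [iteratedDeriv_succ, funext ih]
    have h : HasDerivAt (fun r : ℝ => Complex.I * (r : ℂ)) (Complex.I * 1) r :=
      (Complex.ofRealCLM.hasDerivAt (x := r)).const_mul Complex.I
    rw [(h.cexp.const_mul (Complex.I ^ k)).deriv]
    ring

lemma hasTemperateGrowth_cexp_I_mul :
    (fun r : ℝ => Complex.exp (Complex.I * r)).HasTemperateGrowth := by
  refine ⟨(contDiff_const.mul Complex.ofRealCLM.contDiff).cexp, fun k => ⟨0, 1, fun r => ?_⟩⟩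
  rw [norm_iteratedFDeriv_eq_norm_iteratedDeriv, iteratedDeriv_cexp_I_mul, norm_mul, mul_comm]
  rw [mul_comm Complex.I, Complex.norm_exp_ofReal_mul_I]
  simp

variable {n : ℕ}

lemma hasTemperateGrowth_symbol (t : ℝ) :
    (symbol t : EuclideanSpace ℝ (Fin n) → ℂ).HasTemperateGrowth := by
  have h : (fun ξ : EuclideanSpace ℝ (Fin n) =>
      (t * (2 * Real.pi) ^ 2) * ‖ξ‖ ^ 2).HasTemperateGrowth :=
    (Function.HasTemperateGrowth.const _).mul
      (Function.hasTemperateGrowth_norm_sq _)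
  convert! hasTemperateGrowth_cexp_I_mul.comp h using 1
  ext ξ
  simp only [symbol, Function.comp]
  congr 3
  ring

/-- The Fourier symbol of the translation by `a`. -/
def translationSymbol (a ξ : EuclideanSpace ℝ (Fin n)) : ℂ :=
  Complex.exp (Complex.I * ((-(2 * Real.pi * inner ℝ a ξ) : ℝ) : ℂ))

lemma norm_translationSymbol (a ξ : EuclideanSpace ℝ (Fin n)) : ‖translationSymbol a ξ‖ = 1 := by
  rw [translationSymbol, mul_comm]
  exact Complex.norm_exp_ofReal_mul_I _

lemma hasTemperateGrowth_translationSymbol (a : EuclideanSpace ℝ (Fin n)) :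
    (translationSymbol a).HasTemperateGrowth := by
  have h : (fun ξ : EuclideanSpace ℝ (Fin n) =>
      (-(2 * Real.pi)) * inner ℝ a ξ).HasTemperateGrowth :=
    (Function.HasTemperateGrowth.const _).mul (Function.hasTemperateGrowth_inner_right _)
  convert! hasTemperateGrowth_cexp_I_mul.comp h using 1
  ext ξ
  simp only [translationSymbol, Function.comp]
  congr 3
  ring

/-- The weight `(1 + |2πξ|²)^{s/2}`. -/
def sobolevWeight (s : ℝ) (ξ : EuclideanSpace ℝ (Fin n)) : ℂ :=
  (((1 + (2 * Real.pi * ‖ξ‖) ^ 2) ^ (s / 2) : ℝ) : ℂ)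

lemma hasTemperateGrowth_sobolevWeight (s : ℝ) :
    (sobolevWeight s : EuclideanSpace ℝ (Fin n) → ℂ).HasTemperateGrowth := by
  have h := (Function.hasTemperateGrowth_one_add_norm_sq_rpow
    (EuclideanSpace ℝ (Fin n)) (s / 2)).comp
    ((2 * Real.pi) • ContinuousLinearMap.id ℝ (EuclideanSpace ℝ (Fin n))).hasTemperateGrowth
  convert! Function.Complex.hasTemperateGrowth_ofReal.comp h using 1
  ext ξ
  simp [sobolevWeight, norm_smul, abs_of_pos Real.pi_pos]

lemma continuous_sobolevWeight (s : ℝ) :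
    Continuous (sobolevWeight s : EuclideanSpace ℝ (Fin n) → ℂ) :=
  (hasTemperateGrowth_sobolevWeight s).1.continuous

lemma one_add_sq_pos (ξ : EuclideanSpace ℝ (Fin n)) : 0 < 1 + (2 * Real.pi * ‖ξ‖) ^ 2 := by
  positivity

lemma norm_sobolevWeight (s : ℝ) (ξ : EuclideanSpace ℝ (Fin n)) :
    ‖sobolevWeight s ξ‖ = (1 + (2 * Real.pi * ‖ξ‖) ^ 2) ^ (s / 2) := by
  rw [sobolevWeight, Complex.norm_real, Real.norm_of_nonneg]
  exact Real.rpow_nonneg (one_add_sq_pos ξ).le _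

lemma sobolevWeight_mul_neg (s : ℝ) (ξ : EuclideanSpace ℝ (Fin n)) :
    sobolevWeight s ξ * sobolevWeight (-s) ξ = 1 := by
  rw [sobolevWeight, sobolevWeight, ← Complex.ofReal_mul, ← Real.rpow_add (one_add_sq_pos ξ)]
  simp [neg_div]

lemma norm_sobolevWeight_neg_le {s : ℝ} (hs : 0 ≤ s) (ξ : EuclideanSpace ℝ (Fin n)) :
    ‖sobolevWeight (-s) ξ‖ ≤ 1 := by
  rw [norm_sobolevWeight]
  exact Real.rpow_le_one_of_one_le_of_nonpos (by nlinarith [sq_nonneg (2 * Real.pi * ‖ξ‖)])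
    (by linarith)

lemma sobolevNorm_eq_eLpNorm (s : ℝ) (f : Lp (α := EuclideanSpace ℝ (Fin n)) ℂ 2) :
    sobolevNorm s f = eLpNorm (fun ξ => sobolevWeight s ξ * (𝓕 f : Lp (α := EuclideanSpace ℝ (Fin n)) ℂ 2) ξ) 2 volume := by
  rw [sobolevNorm, eLpNorm_eq_lintegral_rpow_enorm_toReal (by simp) (by simp)]
  simp only [ENNReal.toReal_ofNat]
  congr 1
  refine lintegral_congr fun ξ => ?_
  rw [enorm_mul, ENNReal.mul_rpow_of_nonneg _ _ (by norm_num), ← ofReal_norm (sobolevWeight s ξ),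
    norm_sobolevWeight, ENNReal.ofReal_rpow_of_nonneg (Real.rpow_nonneg (one_add_sq_pos ξ).le _)
    (by norm_num), ← Real.rpow_mul (one_add_sq_pos ξ).le]
  rw [ENNReal.rpow_ofNat]
  congr 3
  ring

lemma sobolevNorm_mono {s s' : ℝ} (h : s ≤ s') (f : Lp (α := EuclideanSpace ℝ (Fin n)) ℂ 2) :
    sobolevNorm s f ≤ sobolevNorm s' f := by
  unfold sobolevNorm
  gcongr with ξ
  nlinarith [sq_nonneg (2 * Real.pi * ‖ξ‖)]

/-! ### The evolution of Schwartz functions -/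

/-- The Schrödinger propagator `e^{itΔ}` on Schwartz functions. -/
def propagator (t : ℝ) :
    𝓢(EuclideanSpace ℝ (Fin n), ℂ) →L[ℂ] 𝓢(EuclideanSpace ℝ (Fin n), ℂ) :=
  SchwartzMap.fourierMultiplierCLM ℂ (symbol t)

lemma fourier_fourierMultiplierCLM_apply {m : EuclideanSpace ℝ (Fin n) → ℂ}
    (hm : m.HasTemperateGrowth) (f : 𝓢(EuclideanSpace ℝ (Fin n), ℂ))
    (ξ : EuclideanSpace ℝ (Fin n)) :
    𝓕 (SchwartzMap.fourierMultiplierCLM ℂ m f) ξ = m ξ * 𝓕 f ξ := by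
  rw [SchwartzMap.fourierMultiplierCLM_apply, FourierTransform.fourier_fourierInv_eq,
    SchwartzMap.smulLeftCLM_apply_apply hm, smul_eq_mul]

lemma propagator_apply (t : ℝ) (f : 𝓢(EuclideanSpace ℝ (Fin n), ℂ))
    (x : EuclideanSpace ℝ (Fin n)) : propagator t f x = evolution t f x := by
  rw [propagator, SchwartzMap.fourierMultiplierCLM_apply, SchwartzMap.fourierInv_coe,
    Real.fourierInv_eq', evolution]
  refine integral_congr_ae (Eventually.of_forall fun ξ => ?_)
  simp only [SchwartzMap.smulLeftCLM_apply_apply (hasTemperateGrowth_symbol t), smul_eq_mul,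
    real_inner_comm]
  rw [mul_comm Complex.I]
  ring

lemma continuous_evolution (t : ℝ) (f : 𝓢(EuclideanSpace ℝ (Fin n), ℂ)) :
    Continuous (evolution t f) := by
  rw [← funext (propagator_apply t f)]
  exact (propagator t f).continuous

lemma evolution_sub (t : ℝ) (f g : 𝓢(EuclideanSpace ℝ (Fin n), ℂ))
    (x : EuclideanSpace ℝ (Fin n)) : evolution t (f - g) x = evolution t f x - evolution t g x := by
  simp [← propagator_apply]

lemma evolution_smul (t : ℝ) (c : ℂ) (f : 𝓢(EuclideanSpace ℝ (Fin n), ℂ))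
    (x : EuclideanSpace ℝ (Fin n)) : evolution t (c • f) x = c * evolution t f x := by
  simp [← propagator_apply]

lemma symbol_mul_symbol (t t' : ℝ) :
    (symbol t * symbol t' : EuclideanSpace ℝ (Fin n) → ℂ) = symbol (t + t') := by
  ext ξ
  rw [Pi.mul_apply, symbol, symbol, symbol, ← Complex.exp_add]
  congr 1
  push_cast
  ring

lemma evolution_propagator (t t' : ℝ) (f : 𝓢(EuclideanSpace ℝ (Fin n), ℂ))
    (x : EuclideanSpace ℝ (Fin n)) :
    evolution t (propagator t' f) x = evolution (t + t') f x := by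
  rw [← propagator_apply, propagator, propagator,
    SchwartzMap.fourierMultiplierCLM_fourierMultiplierCLM_apply (hasTemperateGrowth_symbol t)
    (hasTemperateGrowth_symbol t'), symbol_mul_symbol, ← propagator_apply, propagator]

lemma continuous_evolution_time (f : 𝓢(EuclideanSpace ℝ (Fin n), ℂ))
    (x : EuclideanSpace ℝ (Fin n)) : Continuous fun t => evolution t f x := by
  unfold evolution
  refine continuous_of_dominated (bound := fun ξ => ‖𝓕 f ξ‖) (fun t => ?_) (fun t => ?_)
    (𝓕 f).integrable.norm ?_
  · have := continuous_symbol (n := n) t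
    have := (𝓕 f).continuous
    exact Continuous.aestronglyMeasurable (by fun_prop)
  · refine Eventually.of_forall fun ξ => ?_
    rw [norm_mul, norm_mul, norm_symbol, mul_comm Complex.I, Complex.norm_exp_ofReal_mul_I]
    simp
  · refine Eventually.of_forall fun ξ => ?_
    unfold symbol
    fun_prop

/-- The translation of Schwartz functions by `a`. -/
def translation (a : EuclideanSpace ℝ (Fin n)) :
    𝓢(EuclideanSpace ℝ (Fin n), ℂ) →L[ℂ] 𝓢(EuclideanSpace ℝ (Fin n), ℂ) :=
  SchwartzMap.fourierMultiplierCLM ℂ (translationSymbol a)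

lemma evolution_translation (t : ℝ) (a : EuclideanSpace ℝ (Fin n))
    (f : 𝓢(EuclideanSpace ℝ (Fin n), ℂ)) (x : EuclideanSpace ℝ (Fin n)) :
    evolution t (translation a f) x = evolution t f (x - a) := by
  unfold evolution
  refine integral_congr_ae (Eventually.of_forall fun ξ => ?_)
  simp only [translation,
    fourier_fourierMultiplierCLM_apply (hasTemperateGrowth_translationSymbol a)]
  have : Complex.exp (Complex.I * ((2 * Real.pi * inner ℝ (x - a) ξ : ℝ) : ℂ)) =
      Complex.exp (Complex.I * ((2 * Real.pi * inner ℝ x ξ : ℝ) : ℂ)) * translationSymbol a ξ := by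
    rw [translationSymbol, ← Complex.exp_add, inner_sub_left]
    congr 1
    push_cast
    ring
  rw [this]
  ring

lemma evolutionL2_toLp (t : ℝ) (f : 𝓢(EuclideanSpace ℝ (Fin n), ℂ)) :
    evolutionL2 t (f.toLp 2) = (propagator t f).toLp 2 := by
  rw [evolutionL2, propagator, SchwartzMap.fourierMultiplierCLM_apply,
    ← SchwartzMap.toLp_fourierInv_eq]
  refine congrArg _ ?_
  refine Lp.ext ?_
  refine (MemLp.coeFn_toLp _).trans (EventuallyEq.trans ?_ (SchwartzMap.coeFn_toLp _ 2 volume).symm)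
  rw [SchwartzMap.toLp_fourier_eq]
  filter_upwards [SchwartzMap.coeFn_toLp (𝓕 f) 2] with ξ hξ
  rw [hξ, SchwartzMap.smulLeftCLM_apply_apply (hasTemperateGrowth_symbol t), smul_eq_mul]

lemma coeFn_evolutionL2_toLp (t : ℝ) (f : 𝓢(EuclideanSpace ℝ (Fin n), ℂ)) :
    evolutionL2 t (f.toLp 2) =ᵐ[volume] evolution t f := by
  rw [evolutionL2_toLp, ← funext (propagator_apply t f)]
  exact SchwartzMap.coeFn_toLp _ 2 volume

/-! ### The Sobolev norm of Schwartz functions -/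

/-- The isometric embedding `f ↦ (1 + |2πξ|²)^{s/2} 𝓕 f` of `H^s` into `L²`, on Schwartz
functions. -/
def sobolevEmb (s : ℝ) :
    𝓢(EuclideanSpace ℝ (Fin n), ℂ) →L[ℂ] Lp (α := EuclideanSpace ℝ (Fin n)) ℂ 2 :=
  SchwartzMap.toLpCLM ℂ ℂ 2 volume ∘L SchwartzMap.smulLeftCLM ℂ (sobolevWeight s) ∘L
    FourierTransform.fourierCLM ℂ 𝓢(EuclideanSpace ℝ (Fin n), ℂ)

lemma coeFn_sobolevEmb (s : ℝ) (f : 𝓢(EuclideanSpace ℝ (Fin n), ℂ)) :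
    sobolevEmb s f =ᵐ[volume] fun ξ => sobolevWeight s ξ * 𝓕 f ξ := by
  have h : sobolevEmb s f = (SchwartzMap.smulLeftCLM ℂ (sobolevWeight s) (𝓕 f)).toLp 2 := rfl
  rw [h]
  filter_upwards [SchwartzMap.coeFn_toLp (SchwartzMap.smulLeftCLM ℂ (sobolevWeight s) (𝓕 f)) 2]
    with ξ hξ
  rw [hξ, SchwartzMap.smulLeftCLM_apply_apply (hasTemperateGrowth_sobolevWeight s), smul_eq_mul]

lemma sobolevNorm_toLp (s : ℝ) (f : 𝓢(EuclideanSpace ℝ (Fin n), ℂ)) :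
    sobolevNorm s (f.toLp 2) = ‖sobolevEmb s f‖ₑ := by
  rw [sobolevNorm_eq_eLpNorm, Lp.enorm_def, SchwartzMap.toLp_fourier_eq]
  refine eLpNorm_congr_ae ?_
  filter_upwards [SchwartzMap.coeFn_toLp (𝓕 f) 2, coeFn_sobolevEmb s f] with ξ h1 h2
  rw [h1, h2]

/-- The weight only sees `|𝓕 f|`. Translations are needed for the covering argument and for moving
between balls, the propagator for moving between time intervals. -/
lemma norm_sobolevEmb_fourierMultiplierCLM (s : ℝ) {m : EuclideanSpace ℝ (Fin n) → ℂ}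
    (hm : m.HasTemperateGrowth) (hm1 : ∀ ξ, ‖m ξ‖ = 1) (f : 𝓢(EuclideanSpace ℝ (Fin n), ℂ)) :
    ‖sobolevEmb s (SchwartzMap.fourierMultiplierCLM ℂ m f)‖ = ‖sobolevEmb s f‖ := by
  rw [Lp.norm_def, Lp.norm_def]
  congr 1
  refine eLpNorm_congr_norm_ae ?_
  filter_upwards [coeFn_sobolevEmb s f,
    coeFn_sobolevEmb s (SchwartzMap.fourierMultiplierCLM ℂ m f)] with ξ h1 h2
  rw [h1, h2, fourier_fourierMultiplierCLM_apply hm]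
  simp [hm1]

lemma norm_sobolevEmb_translation (s : ℝ) (a : EuclideanSpace ℝ (Fin n))
    (f : 𝓢(EuclideanSpace ℝ (Fin n), ℂ)) :
    ‖sobolevEmb s (translation a f)‖ = ‖sobolevEmb s f‖ :=
  norm_sobolevEmb_fourierMultiplierCLM s (hasTemperateGrowth_translationSymbol a)
    (norm_translationSymbol a) f

lemma norm_sobolevEmb_propagator (s : ℝ) (t : ℝ) (f : 𝓢(EuclideanSpace ℝ (Fin n), ℂ)) :
    ‖sobolevEmb s (propagator t f)‖ = ‖sobolevEmb s f‖ :=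
  norm_sobolevEmb_fourierMultiplierCLM s (hasTemperateGrowth_symbol t) (norm_symbol t) f

/-! ### Maximal functions over short time intervals -/

/-- The local maximal function `x ↦ sup_{0 < t < δ} |e^{itΔ} f(x)|`. -/
def localMaximal (δ : ℝ) (f : 𝓢(EuclideanSpace ℝ (Fin n), ℂ))
    (x : EuclideanSpace ℝ (Fin n)) : ℝ≥0∞ :=
  ⨆ t ∈ Set.Ioo (0 : ℝ) δ, ‖evolution t f x‖ₑ

lemma maximalFunction_eq_localMaximal (f : 𝓢(EuclideanSpace ℝ (Fin n), ℂ)) :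
    maximalFunction f = localMaximal 1 f := rfl

lemma lt_localMaximal_iff {δ : ℝ} {f : 𝓢(EuclideanSpace ℝ (Fin n), ℂ)}
    {x : EuclideanSpace ℝ (Fin n)} {r : ℝ≥0∞} :
    r < localMaximal δ f x ↔ ∃ t ∈ Set.Ioo (0 : ℝ) δ, r < ‖evolution t f x‖ₑ := by
  simp only [localMaximal, lt_iSup_iff, exists_prop]

lemma isOpen_lt_localMaximal (δ : ℝ) (f : 𝓢(EuclideanSpace ℝ (Fin n), ℂ)) (r : ℝ≥0∞) :
    IsOpen {x | r < localMaximal δ f x} := by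
  have : {x | r < localMaximal δ f x} =
      ⋃ t ∈ Set.Ioo (0 : ℝ) δ, {x | r < ‖evolution t f x‖ₑ} := by
    ext x
    simp [lt_localMaximal_iff]
  rw [this]
  exact isOpen_biUnion fun t _ =>
    isOpen_lt continuous_const (continuous_evolution t f).enorm

lemma localMaximal_translation (δ : ℝ) (a : EuclideanSpace ℝ (Fin n))
    (f : 𝓢(EuclideanSpace ℝ (Fin n), ℂ)) (x : EuclideanSpace ℝ (Fin n)) :
    localMaximal δ (translation a f) x = localMaximal δ f (x - a) := by
  simp [localMaximal, evolution_translation]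

lemma localMaximal_smul (δ : ℝ) (c : ℂ) (f : 𝓢(EuclideanSpace ℝ (Fin n), ℂ))
    (x : EuclideanSpace ℝ (Fin n)) :
    localMaximal δ (c • f) x = ‖c‖ₑ * localMaximal δ f x := by
  simp [localMaximal, evolution_smul, ENNReal.mul_iSup]

/-! ### Random signs -/

/-- The sign attached to a Boolean. -/
def boolSign (b : Bool) : ℂ := if b then 1 else -1

lemma boolSign_not (b : Bool) : boolSign (!b) = -boolSign b := by
  cases b <;> simp [boolSign]

lemma norm_boolSign (b : Bool) : ‖boolSign b‖ = 1 := by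
  cases b <;> simp [boolSign]

/-- Orthogonality of random signs: averaging over one sign at a time is the parallelogram law. -/
lemma sum_norm_sq_signed_sum {H : Type*} [NormedAddCommGroup H] [InnerProductSpace ℂ H] {N : ℕ}
    (h : Fin N → H) :
    ∑ ε : Fin N → Bool, ‖∑ i, boolSign (ε i) • h i‖ ^ 2 = 2 ^ N * ∑ i, ‖h i‖ ^ 2 := by
  induction N with
  | zero => simp
  | succ N ih =>
    have key : ∀ ε : Fin N → Bool, ∑ b : Bool,
        ‖∑ i, boolSign ((Fin.consEquiv fun _ => Bool) (b, ε) i) • h i‖ ^ 2 =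
          2 * ‖h 0‖ ^ 2 + 2 * ‖∑ i, boolSign (ε i) • h i.succ‖ ^ 2 := by
      intro ε
      have := parallelogram_law_with_norm ℂ (∑ i, boolSign (ε i) • h i.succ) (h 0)
      simp only [Fintype.sum_bool, Fin.consEquiv_apply, Fin.sum_univ_succ, Fin.cons_zero,
        Fin.cons_succ, boolSign, if_true, Bool.false_eq_true, if_false, one_smul, neg_smul] at *
      rw [add_comm (h 0), add_comm (-h 0), ← sub_eq_add_neg]
      linarith
    rw [← (Fin.consEquiv fun _ => Bool).sum_comp, Fintype.sum_prod_type_right,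
      Finset.sum_congr rfl fun ε _ => key ε, Finset.sum_add_distrib, ← Finset.mul_sum,
      ← Finset.mul_sum, ih (fun i => h i.succ), Fin.sum_univ_succ]
    simp
    ring

/-- If flipping one coordinate turns every point outside `P` into a point of `P`, then `P` contains
at least half of the sign patterns. -/
lemma two_pow_le_two_mul_card_of_flip {N : ℕ} (P : (Fin N → Bool) → Prop) [DecidablePred P]
    (i : Fin N) (hP : ∀ ε, ¬ P ε → P (Function.update ε i (!ε i))) :
    2 ^ N ≤ 2 * (Finset.univ.filter P).card := by
  have hinj : (Finset.univ.filter fun ε => ¬ P ε).card ≤ (Finset.univ.filter P).card := by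
    refine Finset.card_le_card_of_injOn (fun ε => Function.update ε i (!ε i)) ?_ ?_
    · intro ε hε
      simp only [Finset.coe_filter, Finset.mem_univ, true_and, Set.mem_ofPred_eq] at hε ⊢
      exact hP ε hε
    · intro ε _ ε' _ h
      have h2 := congrArg (fun η => Function.update η i (!η i)) h
      simpa using h2
  have := Finset.card_filter_add_card_filter_not (s := (Finset.univ : Finset (Fin N → Bool))) P
  simp only [Finset.card_univ, Fintype.card_pi, Fintype.card_bool, Finset.prod_const,
    Fintype.card_fin] at this
  omega

/-! ### Covering the ball by translates of a set -/

/-- By Fubini, the overlap of `U` with the translate of `F` by `v` integrates over `v` to `|U| |F|`.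
Overlap occurs only for `v` in the ball of radius 2, so some `v` there is at least average. -/
lemma exists_translate_inter_large {F U : Set (EuclideanSpace ℝ (Fin n))}
    (hF : MeasurableSet F) (hFB : F ⊆ Metric.ball 0 1) (hU : MeasurableSet U)
    (hUB : U ⊆ Metric.ball 0 1) :
    ∃ v : EuclideanSpace ℝ (Fin n), volume.real U * volume.real F ≤
      volume.real (Metric.ball (0 : EuclideanSpace ℝ (Fin n)) 2) *
        volume.real (U ∩ (fun x => x - v) ⁻¹' F) := by
  set B₂ := Metric.ball (0 : EuclideanSpace ℝ (Fin n)) 2 with hB₂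
  have hB₂0 : volume B₂ ≠ 0 := (Metric.measure_ball_pos volume _ two_pos).ne'
  have hB₂t : volume B₂ ≠ ∞ := measure_ball_lt_top.ne
  have hmeas : ∀ v, MeasurableSet (U ∩ (fun x => x - v) ⁻¹' F) := fun v =>
    hU.inter ((measurable_id.sub_const v) hF)
  have hint : ∫⁻ v in B₂, volume (U ∩ (fun x => x - v) ⁻¹' F) = volume U * volume F := by
    have h1 : ∀ v, volume (U ∩ (fun x => x - v) ⁻¹' F) =
        ∫⁻ x in U, F.indicator (1 : EuclideanSpace ℝ (Fin n) → ℝ≥0∞) (x - v) := by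
      intro v
      rw [← lintegral_indicator_one (hmeas v), ← lintegral_indicator hU]
      refine lintegral_congr fun x => ?_
      by_cases hx : x ∈ U <;> by_cases hx' : x - v ∈ F <;> simp [hx, hx', Set.indicator]
    simp only [h1]
    rw [lintegral_lintegral_swap]
    · have h2 : ∀ x ∈ U, ∫⁻ v in B₂, F.indicator (1 : EuclideanSpace ℝ (Fin n) → ℝ≥0∞) (x - v) = volume F := by
        intro x hx
        rw [← lintegral_indicator measurableSet_ball]
        have h3 : ∀ v, B₂.indicator (fun v => F.indicator (1 : EuclideanSpace ℝ (Fin n) → ℝ≥0∞) (x - v)) v =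
            F.indicator (1 : EuclideanSpace ℝ (Fin n) → ℝ≥0∞) (x - v) := by
          intro v
          by_cases hv : v ∈ B₂
          · simp [hv]
          · have : x - v ∉ F := by
              intro hxv
              apply hv
              have h4 := mem_ball_zero_iff.1 (hFB hxv)
              have h5 := mem_ball_zero_iff.1 (hUB hx)
              rw [hB₂, mem_ball_zero_iff]
              calc ‖v‖ = ‖x - (x - v)‖ := by congr 1; abel
                _ ≤ ‖x‖ + ‖x - v‖ := norm_sub_le _ _
                _ < 2 := by linarith
            simp [hv, this]
        rw [lintegral_congr h3]
        rw [lintegral_sub_left_eq_self (fun v => F.indicator (1 : EuclideanSpace ℝ (Fin n) → ℝ≥0∞) v) x,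
          lintegral_indicator_one hF]
      rw [setLIntegral_congr_fun hU h2, setLIntegral_const, mul_comm]
    · refine Measurable.aemeasurable ?_
      exact (measurable_one.indicator hF).comp (measurable_snd.sub measurable_fst)
  obtain ⟨v, -, hv⟩ := exists_setLAverage_le hB₂0 measurableSet_ball.nullMeasurableSet
    (f := fun v => volume (U ∩ (fun x => x - v) ⁻¹' F)) (by
      rw [hint]
      exact ENNReal.mul_ne_top ((measure_mono hUB).trans_lt measure_ball_lt_top).ne
        ((measure_mono hFB).trans_lt measure_ball_lt_top).ne)
  refine ⟨v, ?_⟩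
  rw [setLAverage_eq, hint, ENNReal.div_le_iff hB₂0 hB₂t, mul_comm _ (volume B₂)] at hv
  have hfin : volume B₂ * volume (U ∩ (fun x => x - v) ⁻¹' F) ≠ ∞ :=
    ENNReal.mul_ne_top hB₂t (((measure_mono Set.inter_subset_left).trans
      (measure_mono hUB)).trans_lt measure_ball_lt_top).ne
  simpa [Measure.real, ENNReal.toReal_mul] using ENNReal.toReal_mono hfin hv

/-- Greedy choice: each new translate removes at least the fraction `|F| / |B(0,2)|` of what is
still uncovered. -/
lemma exists_translates_cover {F : Set (EuclideanSpace ℝ (Fin n))}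
    (hF : MeasurableSet F) (hFB : F ⊆ Metric.ball 0 1) (N : ℕ) :
    ∃ v : Fin N → EuclideanSpace ℝ (Fin n),
      volume.real (Metric.ball 0 1 \ ⋃ i, (fun x => x - v i) ⁻¹' F) ≤
        (1 - volume.real F / volume.real (Metric.ball (0 : EuclideanSpace ℝ (Fin n)) 2)) ^ N *
          volume.real (Metric.ball (0 : EuclideanSpace ℝ (Fin n)) 1) := by
  have hB₂ : 0 < volume.real (Metric.ball (0 : EuclideanSpace ℝ (Fin n)) 2) :=
    ENNReal.toReal_pos (Metric.measure_ball_pos volume _ two_pos).ne' measure_ball_lt_top.ne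
  have hp : 0 ≤ 1 - volume.real F /
      volume.real (Metric.ball (0 : EuclideanSpace ℝ (Fin n)) 2) := by
    rw [sub_nonneg, div_le_one hB₂]
    exact measureReal_mono (hFB.trans (Metric.ball_subset_ball one_le_two)) measure_ball_lt_top.ne
  induction N with
  | zero => exact ⟨Fin.elim0, by simp⟩
  | succ N ih =>
    obtain ⟨v, hv⟩ := ih
    set U := Metric.ball 0 1 \ ⋃ i, (fun x => x - v i) ⁻¹' F with hU
    have hUm : MeasurableSet U :=
      measurableSet_ball.diff (MeasurableSet.iUnion fun i => (measurable_id.sub_const _) hF)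
    have hUB : U ⊆ Metric.ball 0 1 := Set.sdiff_subset
    obtain ⟨w, hw⟩ := exists_translate_inter_large hF hFB hUm hUB
    refine ⟨Fin.cons w v, ?_⟩
    have heq : Metric.ball 0 1 \ ⋃ i, (fun x => x - (Fin.cons w v : Fin (N + 1) → _) i) ⁻¹' F =
        U \ (U ∩ (fun x => x - w) ⁻¹' F) := by
      ext x
      simp only [hU, Set.mem_sdiff, Set.mem_iUnion, Set.mem_preimage, Fin.exists_fin_succ,
        Fin.cons_zero, Fin.cons_succ, Set.mem_inter_iff, not_or, not_and]
      tauto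
    have hUt : volume U ≠ ∞ := ((measure_mono hUB).trans_lt measure_ball_lt_top).ne
    have hwm : MeasurableSet (U ∩ (fun x => x - w) ⁻¹' F) :=
      hUm.inter ((measurable_id.sub_const w) hF)
    rw [heq, measureReal_sdiff Set.inter_subset_left hwm hUt, pow_succ']
    have h1 : volume.real U * (volume.real F /
        volume.real (Metric.ball (0 : EuclideanSpace ℝ (Fin n)) 2)) ≤
          volume.real (U ∩ (fun x => x - w) ⁻¹' F) := by
      rw [← mul_div_assoc, div_le_iff₀ hB₂]
      linarith
    have h2 := mul_le_mul_of_nonneg_left hv hp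
    nlinarith

/-! ### From a bound in measure to a weak-type bound -/

/-- The heart of Stein's principle. If the bound failed, the signed sums of `N` translates of `f`
would have mean square norm at most `A² / 8`, so most of them obey `h`. Yet on average over the
signs their maximal functions exceed 1 on at least a quarter of the ball. -/
lemma volume_real_sq_le_of_small {s δ A : ℝ} (hA : 0 < A)
    (h : ∀ f : 𝓢(EuclideanSpace ℝ (Fin n), ℂ), ‖sobolevEmb s f‖ ≤ A →
      volume.real ({x | 1 < localMaximal δ f x} ∩ Metric.ball 0 1) ≤
        volume.real (Metric.ball (0 : EuclideanSpace ℝ (Fin n)) 1) / 16)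
    (f : 𝓢(EuclideanSpace ℝ (Fin n), ℂ)) :
    volume.real ({x | 1 < localMaximal δ f x} ∩ Metric.ball 0 1) ≤
      16 * volume.real (Metric.ball (0 : EuclideanSpace ℝ (Fin n)) 2) / A ^ 2 *
        ‖sobolevEmb s f‖ ^ 2 := by
  set F := {x | 1 < localMaximal δ f x} ∩ Metric.ball 0 1 with hFdef
  have hF : MeasurableSet F :=
    (isOpen_lt_localMaximal δ f 1).measurableSet.inter measurableSet_ball
  have hFB : F ⊆ Metric.ball 0 1 := Set.inter_subset_right
  set b := volume.real (Metric.ball (0 : EuclideanSpace ℝ (Fin n)) 1) with hb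
  have hb0 : 0 < b :=
    ENNReal.toReal_pos (Metric.measure_ball_pos volume _ one_pos).ne' measure_ball_lt_top.ne
  set b₂ := volume.real (Metric.ball (0 : EuclideanSpace ℝ (Fin n)) 2) with hb₂
  have hb₂0 : 0 < b₂ :=
    ENNReal.toReal_pos (Metric.measure_ball_pos volume _ two_pos).ne' measure_ball_lt_top.ne
  rcases eq_or_lt_of_le (measureReal_nonneg (μ := volume) (s := F)) with hF0 | hF0
  · rw [← hF0]
    positivity
  set p := volume.real F / b₂ with hp
  have hp0 : 0 < p := div_pos hF0 hb₂0
  have hp1 : p ≤ 1 := by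
    rw [hp, div_le_one hb₂0]
    exact measureReal_mono (hFB.trans (Metric.ball_subset_ball one_le_two)) measure_ball_lt_top.ne
  -- Enough translates for `(1 - p)^N ≤ e⁻¹ ≤ 1/2`, so that half of the ball is covered, but no more
  -- than `2 / p`.
  set N := ⌈1 / p⌉₊ with hN
  have hN1 : 1 / p ≤ N := Nat.le_ceil _
  have hN2 : (N : ℝ) ≤ 2 / p := by
    have h1 : (N : ℝ) < 1 / p + 1 := Nat.ceil_lt_add_one (by positivity)
    have h2 : 1 ≤ 1 / p := (one_le_div hp0).2 hp1
    have h3 : 2 / p = 1 / p + 1 / p := by ring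
    linarith
  obtain ⟨v, hv⟩ := exists_translates_cover hF hFB N
  have hexp : (1 - p) ^ N ≤ 1 / 2 := by
    calc (1 - p) ^ N ≤ Real.exp (-p) ^ N := by
          gcongr
          linarith [Real.add_one_le_exp (-p)]
      _ = Real.exp (-(N * p)) := by rw [← Real.exp_nat_mul]; congr 1; ring
      _ ≤ Real.exp (-1) := by
          gcongr
          rwa [div_le_iff₀ hp0] at hN1
      _ ≤ 1 / 2 := by
          rw [Real.exp_neg, ← one_div]
          exact one_div_le_one_div_of_le two_pos (by linarith [Real.add_one_le_exp (1 : ℝ)])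
  set G := Metric.ball 0 1 ∩ ⋃ i, (fun x => x - v i) ⁻¹' F with hG
  have hGm : MeasurableSet G :=
    measurableSet_ball.inter (MeasurableSet.iUnion fun i => (measurable_id.sub_const _) hF)
  have hGb : b / 2 ≤ volume.real G := by
    have hm : MeasurableSet (⋃ i, (fun x => x - v i) ⁻¹' F) :=
      MeasurableSet.iUnion fun i => (measurable_id.sub_const (v i)) hF
    have h1 := measureReal_inter_add_sdiff (μ := volume)
      (s := Metric.ball (0 : EuclideanSpace ℝ (Fin n)) 1) hm measure_ball_lt_top.ne
    have h2 : volume.real (Metric.ball 0 1 \ ⋃ i, (fun x => x - v i) ⁻¹' F) ≤ 1 / 2 * b :=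
      hv.trans (by gcongr)
    linarith
  set S : (Fin N → Bool) → 𝓢(EuclideanSpace ℝ (Fin n), ℂ) := fun ε =>
    ∑ i, boolSign (ε i) • translation (v i) f with hS
  set Hs : (Fin N → Bool) → Set (EuclideanSpace ℝ (Fin n)) := fun ε =>
    {x | 1 < localMaximal δ (S ε) x} ∩ Metric.ball 0 1 with hHs
  have hHm : ∀ ε, MeasurableSet (Hs ε) := fun ε =>
    (isOpen_lt_localMaximal δ (S ε) 1).measurableSet.inter measurableSet_ball
  have hHt : ∀ ε, volume (Hs ε) ≠ ∞ := fun ε =>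
    ((measure_mono Set.inter_subset_right).trans_lt measure_ball_lt_top).ne
  classical
  have hcount : ∀ x ∈ G, 2 ^ N ≤ 2 * (Finset.univ.filter fun ε => x ∈ Hs ε).card := by
    rintro x ⟨hxB, hx⟩
    obtain ⟨i, hi⟩ := Set.mem_iUnion.1 hx
    obtain ⟨t, ht, hlt⟩ := lt_localMaximal_iff.1 hi.1
    refine two_pow_le_two_mul_card_of_flip _ i fun ε hε => ⟨?_, hxB⟩
    set ε' := Function.update ε i (!ε i) with hε'
    have hle : ¬ 1 < localMaximal δ (S ε) x := fun h' => hε ⟨h', hxB⟩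
    have hle' : ‖evolution t (S ε) x‖ₑ ≤ 1 := by
      by_contra hcon
      exact hle (lt_localMaximal_iff.2 ⟨t, ht, not_le.1 hcon⟩)
    refine lt_localMaximal_iff.2 ⟨t, ht, ?_⟩
    -- At the same time `t`, the two evolutions differ by twice a number of modulus greater than 1,
    -- so they cannot both have modulus at most 1.
    have hdiff : S ε - S ε' = (2 * boolSign (ε i)) • translation (v i) f := by
      simp only [hS]
      rw [← Finset.sum_sub_distrib, Finset.sum_eq_single i]
      · rw [hε', Function.update_self, boolSign_not, ← sub_smul]
        congr 1
        ring
      · intro j _ hj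
        rw [hε', Function.update_of_ne hj, sub_self]
      · simp
    have hev : evolution t (S ε) x - evolution t (S ε') x =
        2 * boolSign (ε i) * evolution t f (x - v i) := by
      rw [← evolution_sub, hdiff, evolution_smul, evolution_translation]
    have hnorm := congrArg norm hev
    rw [norm_mul, norm_mul, norm_boolSign, RCLike.norm_ofNat, mul_one] at hnorm
    have htri := norm_sub_le (evolution t (S ε) x) (evolution t (S ε') x)
    rw [← ofReal_norm, ← ENNReal.ofReal_one] at hlt hle' ⊢
    rw [ENNReal.ofReal_lt_ofReal_iff_of_nonneg zero_le_one] at hlt ⊢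
    rw [ENNReal.ofReal_le_ofReal_iff zero_le_one] at hle'
    linarith
  have hlower : 2 ^ N * b / 4 ≤ ∑ ε, volume.real (Hs ε) := by
    have h1 : ∑ ε, volume.real (Hs ε) = ∫ x, ∑ ε, (Hs ε).indicator (1 : EuclideanSpace ℝ (Fin n) → ℝ) x := by
      rw [integral_finsetSum]
      · simp only [integral_indicator_one (hHm _)]
      · exact fun ε _ => (integrable_indicator_iff (hHm ε)).2 (integrable_const_iff.2 (Or.inr (isFiniteMeasure_restrict.2 (hHt ε))))
    have h2 : ∫ x, G.indicator (fun _ => (2 ^ N / 2 : ℝ)) x ≤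
        ∫ x, ∑ ε, (Hs ε).indicator (1 : EuclideanSpace ℝ (Fin n) → ℝ) x := by
      refine integral_mono ((integrable_indicator_iff hGm).2 (integrable_const_iff.2 (Or.inr
        (isFiniteMeasure_restrict.2
          ((measure_mono Set.inter_subset_left).trans_lt measure_ball_lt_top).ne))))
        (integrable_finsetSum _ fun ε _ =>
          (integrable_indicator_iff (hHm ε)).2 (integrable_const_iff.2 (Or.inr (isFiniteMeasure_restrict.2 (hHt ε))))) fun x => ?_
      by_cases hx : x ∈ G
      · have h3 : (2 ^ N : ℝ) ≤ 2 * ((Finset.univ.filter fun ε => x ∈ Hs ε).card : ℝ) := by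
          exact_mod_cast hcount x hx
        have h4 : ∑ ε, (Hs ε).indicator (1 : EuclideanSpace ℝ (Fin n) → ℝ) x =
            ((Finset.univ.filter fun ε => x ∈ Hs ε).card : ℝ) := by
          rw [Finset.card_filter]
          push_cast
          refine Finset.sum_congr rfl fun ε _ => ?_
          by_cases hε : x ∈ Hs ε <;> simp [hε]
        simp only [Set.indicator_of_mem hx, h4]
        linarith
      · simp only [Set.indicator_of_notMem hx]
        exact Finset.sum_nonneg fun ε _ => Set.indicator_nonneg (fun _ _ => zero_le_one) _
    rw [integral_indicator hGm, setIntegral_const, smul_eq_mul] at h2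
    rw [h1]
    have h4 : b / 2 * (2 ^ N / 2) ≤ volume.real G * (2 ^ N / 2) := by gcongr
    linarith
  by_contra! hcon
  have hsmall : N * ‖sobolevEmb s f‖ ^ 2 ≤ A ^ 2 / 8 := by
    have h1 : 16 * b₂ * ‖sobolevEmb s f‖ ^ 2 ≤ A ^ 2 * volume.real F := by
      rw [div_mul_eq_mul_div, div_lt_iff₀ (by positivity)] at hcon
      linarith
    have h2 : N * p ≤ 2 := by rwa [le_div_iff₀ hp0] at hN2
    have h3 : N * volume.real F ≤ 2 * b₂ := by
      rw [hp, ← mul_div_assoc, div_le_iff₀ hb₂0] at h2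
      exact h2
    have h4 : (16 * b₂) * (N * ‖sobolevEmb s f‖ ^ 2) ≤ (16 * b₂) * (A ^ 2 / 8) := by
      calc _ = N * (16 * b₂ * ‖sobolevEmb s f‖ ^ 2) := by ring
        _ ≤ N * (A ^ 2 * volume.real F) := by gcongr
        _ = A ^ 2 * (N * volume.real F) := by ring
        _ ≤ A ^ 2 * (2 * b₂) := by gcongr
        _ = _ := by ring
    exact le_of_mul_le_mul_left h4 (by positivity)
  have hsq : ∑ ε, ‖sobolevEmb s (S ε)‖ ^ 2 ≤ 2 ^ N * (A ^ 2 / 8) := by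
    have h1 := sum_norm_sq_signed_sum fun i => sobolevEmb s (translation (v i) f)
    simp only [norm_sobolevEmb_translation, Finset.sum_const, Finset.card_univ,
      Fintype.card_fin, nsmul_eq_mul] at h1
    simp only [hS, map_sum, map_smul]
    rw [h1]
    gcongr
  -- Chebyshev: a sum of norm above `A` is charged the whole ball, which `‖·‖² / A² ≥ 1` pays for.
  -- The total is at most `2^N (b/16 + b/8)`, below the lower bound `2^N b/4`.
  have hupper : ∑ ε, volume.real (Hs ε) ≤
      ∑ ε, (b / 16 + b * (‖sobolevEmb s (S ε)‖ ^ 2 / A ^ 2)) := by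
    refine Finset.sum_le_sum fun ε _ => ?_
    by_cases hε : ‖sobolevEmb s (S ε)‖ ≤ A
    · have := h (S ε) hε
      have : 0 ≤ b * (‖sobolevEmb s (S ε)‖ ^ 2 / A ^ 2) := by positivity
      simp only [hHs]
      linarith
    · have h1 : volume.real (Hs ε) ≤ b :=
        measureReal_mono Set.inter_subset_right measure_ball_lt_top.ne
      have h2 : 1 ≤ ‖sobolevEmb s (S ε)‖ ^ 2 / A ^ 2 := by
        rw [one_le_div (by positivity)]
        exact pow_le_pow_left₀ hA.le (not_le.1 hε).le 2
      nlinarith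
  rw [Finset.sum_add_distrib, ← Finset.mul_sum, Finset.sum_const, nsmul_eq_mul,
    ← Finset.sum_div] at hupper
  simp only [Finset.card_univ, Fintype.card_pi, Fintype.card_bool,
    Finset.prod_const, Fintype.card_fin, Nat.cast_pow, Nat.cast_ofNat] at hupper
  have h5 : (∑ ε, ‖sobolevEmb s (S ε)‖ ^ 2) / A ^ 2 ≤ 2 ^ N / 8 := by
    rw [div_le_iff₀ (by positivity)]
    linarith
  have h6 := mul_le_mul_of_nonneg_left h5 hb0.le
  have h7 : 0 < 2 ^ N * b := by positivity
  linarith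

/-! ### A uniform bound in measure from almost everywhere boundedness -/

section Baire

variable {α X : Type*} [MeasurableSpace α] {μ : Measure α} [NormedAddCommGroup X]
  [NormedSpace ℂ X]

/-- The set where some `|T_q g|`, with `q` rational in `(0, δ)`, exceeds `c`. -/
def exceedSet (T : ℝ → X →L[ℂ] Lp ℂ 2 μ) (δ c : ℝ) (g : X) : Set α :=
  {x | ∃ q : ℚ, (q : ℝ) ∈ Set.Ioo 0 δ ∧ c < ‖T q g x‖}

lemma measurableSet_exceedSet (T : ℝ → X →L[ℂ] Lp ℂ 2 μ) (δ c : ℝ) (g : X) :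
    MeasurableSet (exceedSet T δ c g) := by
  have : exceedSet T δ c g =
      ⋃ q : ℚ, ⋃ _ : (q : ℝ) ∈ Set.Ioo 0 δ, {x | c < ‖T q g x‖} := by
    ext x
    simp [exceedSet, and_assoc]
  rw [this]
  exact MeasurableSet.iUnion fun q => MeasurableSet.iUnion fun _ =>
    measurableSet_lt measurable_const (Lp.stronglyMeasurable _).norm.measurable

/-- The exceedance set is an increasing union of sets `V m` that involve finitely many rational
times and a margin `1 / (m + 1)`. For each of these, convergence in measure of `T_q g_k` suffices to
pass to the limit. -/
lemma isClosed_measure_exceedSet_le (T : ℝ → X →L[ℂ] Lp ℂ 2 μ) (δ c : ℝ) (B : Set α) (ε : ℝ≥0∞) :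
    IsClosed {g | μ.restrict B (exceedSet T δ c g) ≤ ε} := by
  refine IsSeqClosed.isClosed fun g g₀ hg hlim => ?_
  have hQ : ∀ m : ℕ, {q : ℚ | Encodable.encode q ≤ m}.Finite := fun m =>
    (Set.finite_Iic m).preimage Encodable.encode_injective.injOn
  set V : ℕ → Set α := fun m => {x | ∃ q : ℚ, Encodable.encode q ≤ m ∧ (q : ℝ) ∈ Set.Ioo 0 δ ∧
    c + 1 / ((m : ℝ) + 1) < ‖T q g₀ x‖} with hV
  have hVmono : Monotone V := by
    rintro m m' hm x ⟨q, hq, hqδ, hlt⟩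
    refine ⟨q, hq.trans hm, hqδ, lt_of_le_of_lt ?_ hlt⟩
    gcongr
  have hVU : exceedSet T δ c g₀ = ⋃ m, V m := by
    ext x
    simp only [Set.mem_iUnion]
    constructor
    · rintro ⟨q, hq, hlt⟩
      obtain ⟨m, hm⟩ := exists_nat_one_div_lt (sub_pos.2 hlt)
      refine ⟨max m (Encodable.encode q), q, le_max_right _ _, hq, ?_⟩
      have : 1 / (((max m (Encodable.encode q) : ℕ) : ℝ) + 1) ≤ 1 / ((m : ℝ) + 1) := by
        gcongr
        exact le_max_left _ _
      linarith
    · rintro ⟨m, q, -, hq, hlt⟩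
      refine ⟨q, hq, lt_trans ?_ hlt⟩
      have : 0 < 1 / ((m : ℝ) + 1) := by positivity
      linarith
  change μ.restrict B (exceedSet T δ c g₀) ≤ ε
  rw [hVU, hVmono.measure_iUnion]
  refine iSup_le fun m => ?_
  set W : ℕ → ℚ → Set α := fun k q => {x | 1 / ((m : ℝ) + 1) ≤ ‖T q (g k) x - T q g₀ x‖} with hW
  have hsub : ∀ k, μ.restrict B (V m) ≤ ε + ∑ q ∈ (hQ m).toFinset, μ (W k q) := by
    intro k
    have h1 : V m ⊆ exceedSet T δ c (g k) ∪ ⋃ q ∈ (hQ m).toFinset, W k q := by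
      rintro x ⟨q, hq, hqδ, hlt⟩
      by_cases hx : c < ‖T q (g k) x‖
      · exact Or.inl ⟨q, hqδ, hx⟩
      · refine Or.inr (Set.mem_biUnion ((hQ m).mem_toFinset.2 hq) ?_)
        have := norm_sub_norm_le (T q g₀ x) (T q (g k) x)
        rw [norm_sub_rev] at this
        simp only [hW, Set.mem_ofPred_eq]
        linarith
    calc μ.restrict B (V m) ≤ μ.restrict B (exceedSet T δ c (g k)) +
          μ.restrict B (⋃ q ∈ (hQ m).toFinset, W k q) :=
          (measure_mono h1).trans (measure_union_le _ _)
      _ ≤ ε + ∑ q ∈ (hQ m).toFinset, μ (W k q) := by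
          refine add_le_add (hg k) ((Measure.restrict_apply_le _ _).trans
            (measure_biUnion_finset_le _ _))
  have htend : Tendsto (fun k => ε + ∑ q ∈ (hQ m).toFinset, μ (W k q)) atTop (𝓝 (ε + 0)) := by
    refine tendsto_const_nhds.add ?_
    rw [← Finset.sum_const_zero (s := (hQ m).toFinset)]
    refine tendsto_finsetSum _ fun q _ => ?_
    have h2 : Tendsto (fun k => T q (g k)) atTop (𝓝 (T q g₀)) :=
      ((T q).continuous.tendsto g₀).comp hlim
    have h3 := tendstoInMeasure_of_tendsto_Lp h2
    rw [tendstoInMeasure_iff_norm] at h3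
    exact h3 _ (by positivity)
  rw [add_zero] at htend
  exact ge_of_tendsto' htend hsub

lemma exists_measure_exceedSet_le [CompleteSpace X] (T : ℝ → X →L[ℂ] Lp ℂ 2 μ) {B : Set α}
    (hB : μ B ≠ ∞)
    (hT : ∀ g, ∀ᵐ x ∂μ, ∃ δ > 0, ∃ M : ℝ, ∀ q : ℚ, (q : ℝ) ∈ Set.Ioo 0 δ → ‖T q g x‖ ≤ M)
    {ε : ℝ≥0∞} (hε : ε ≠ 0) :
    ∃ δ > 0, ∃ A > 0, ∀ g, ‖g‖ ≤ A → μ.restrict B (exceedSet T δ 1 g) ≤ ε + ε := by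
  have : IsFiniteMeasure (μ.restrict B) := isFiniteMeasure_restrict.2 hB
  set K : ℕ → Set X := fun j =>
    {g | μ.restrict B (exceedSet T (1 / ((j : ℝ) + 1)) ((j : ℝ) + 1) g) ≤ ε} with hK
  have hcover : ⋃ j, K j = Set.univ := by
    refine Set.eq_univ_of_forall fun g => Set.mem_iUnion.2 ?_
    have hanti : Antitone fun j : ℕ => exceedSet T (1 / ((j : ℝ) + 1)) ((j : ℝ) + 1) g := by
      rintro i j hij x ⟨q, hq, hlt⟩
      refine ⟨q, ⟨hq.1, hq.2.trans_le ?_⟩, lt_of_le_of_lt ?_ hlt⟩ <;> gcongr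
    have hlim := tendsto_measure_iInter_atTop (μ := μ.restrict B)
      (fun j : ℕ => (measurableSet_exceedSet T (1 / ((j : ℝ) + 1)) ((j : ℝ) + 1)
        g).nullMeasurableSet) hanti ⟨0, measure_ne_top _ _⟩
    have hzero : μ.restrict B
        (⋂ j : ℕ, exceedSet T (1 / ((j : ℝ) + 1)) ((j : ℝ) + 1) g) = 0 := by
      refine measure_mono_null (fun x hx => ?_) (ae_iff.1 (ae_restrict_of_ae (hT g)))
      simp only [Set.mem_ofPred_eq]
      rintro ⟨δ, hδ, M, hM⟩
      obtain ⟨j₁, hj₁⟩ := exists_nat_one_div_lt hδ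
      obtain ⟨j₂, hj₂⟩ := exists_nat_ge M
      obtain ⟨q, hq, hlt⟩ := Set.mem_iInter.1 hx (max j₁ j₂)
      have h1 : 1 / (((max j₁ j₂ : ℕ) : ℝ) + 1) ≤ 1 / ((j₁ : ℝ) + 1) := by
        gcongr
        exact le_max_left _ _
      have h2 : (j₂ : ℝ) ≤ ((max j₁ j₂ : ℕ) : ℝ) := by exact_mod_cast le_max_right _ _
      have h3 := hM q ⟨hq.1, hq.2.trans (by linarith)⟩
      linarith
    rw [hzero] at hlim
    obtain ⟨j, hj⟩ := (hlim.eventually_lt_const (pos_iff_ne_zero.2 hε)).exists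
    exact ⟨j, hj.le⟩
  obtain ⟨j, g₀, hg₀⟩ := nonempty_interior_of_iUnion_of_closed
    (fun j => isClosed_measure_exceedSet_le T _ _ B ε) hcover
  obtain ⟨r, hr, hball⟩ := Metric.isOpen_iff.1 isOpen_interior g₀ hg₀
  have hball' : Metric.ball g₀ r ⊆ K j := hball.trans interior_subset
  set c : ℝ := (j : ℝ) + 1 with hc
  have hc0 : 0 < c := by positivity
  refine ⟨1 / c, by positivity, r / (4 * c), by positivity, fun h hh => ?_⟩
  -- With the factor `2c`, `|T_q h| > 1` forces `|T_q (g₀ + g)| > c` or `|T_q g₀| > c`. The radius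
  -- `r / (4c)` keeps `g₀ + g` inside the ball.
  set g : X := ((2 * c : ℝ) : ℂ) • h with hg
  have hgn : ‖g‖ < r := by
    rw [hg, norm_smul, Complex.norm_real, Real.norm_of_nonneg (by positivity)]
    rw [le_div_iff₀ (by positivity)] at hh
    nlinarith [norm_nonneg h]
  have h1 : g₀ + g ∈ K j := hball' (by simpa [Metric.mem_ball, dist_eq_norm] using hgn)
  have h2 : g₀ ∈ K j := hball' (Metric.mem_ball_self hr)
  have hae : ∀ᵐ x ∂μ, ∀ q : ℚ, ((2 * c : ℝ) : ℂ) * T q h x = T q (g₀ + g) x - T q g₀ x := by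
    rw [ae_all_iff]
    intro q
    have h3 : ((2 * c : ℝ) : ℂ) • T q h = T q (g₀ + g) - T q g₀ := by
      rw [map_add, add_sub_cancel_left, hg, map_smul]
    filter_upwards [Lp.coeFn_smul ((2 * c : ℝ) : ℂ) (T q h),
      Lp.coeFn_sub (T q (g₀ + g)) (T q g₀)] with x hx1 hx2
    rw [h3, hx2] at hx1
    simpa using hx1.symm
  calc μ.restrict B (exceedSet T (1 / c) 1 h)
      ≤ μ.restrict B (exceedSet T (1 / c) c (g₀ + g) ∪ exceedSet T (1 / c) c g₀) := by
        refine measure_mono_ae ?_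
        filter_upwards [ae_restrict_of_ae hae] with x hx
        rintro ⟨q, hq, hlt⟩
        by_cases hx1 : c < ‖T q g₀ x‖
        · exact Or.inr ⟨q, hq, hx1⟩
        · refine Or.inl ⟨q, hq, ?_⟩
          have h4 := congrArg norm (hx q)
          rw [norm_mul, Complex.norm_real, Real.norm_of_nonneg (by positivity)] at h4
          have h5 := norm_sub_le (T q (g₀ + g) x) (T q g₀ x)
          nlinarith
    _ ≤ ε + ε := (measure_union_le _ _).trans (add_le_add h1 h2)

end Baire

/-! ### Bounded multipliers on `L²` -/

lemma memLp_mul_of_norm_le_one {m : EuclideanSpace ℝ (Fin n) → ℂ} (hm : Continuous m)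
    (hm1 : ∀ ξ, ‖m ξ‖ ≤ 1) (g : Lp (α := EuclideanSpace ℝ (Fin n)) ℂ 2) :
    MemLp (fun ξ => m ξ * g ξ) 2 volume := by
  refine (Lp.memLp g).of_le (hm.aestronglyMeasurable.mul (Lp.aestronglyMeasurable g))
    (Eventually.of_forall fun ξ => ?_)
  rw [norm_mul]
  exact mul_le_of_le_one_left (norm_nonneg _) (hm1 ξ)

/-- Multiplication by a continuous function of modulus at most one, as an operator on `L²`. -/
def contractionMul (m : EuclideanSpace ℝ (Fin n) → ℂ) (hm : Continuous m) (hm1 : ∀ ξ, ‖m ξ‖ ≤ 1) :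
    Lp (α := EuclideanSpace ℝ (Fin n)) ℂ 2 →L[ℂ] Lp (α := EuclideanSpace ℝ (Fin n)) ℂ 2 :=
  have hmem := memLp_mul_of_norm_le_one hm hm1
  LinearMap.mkContinuous
    { toFun := fun g => (hmem g).toLp
      map_add' := fun g g' => by
        refine Lp.ext ?_
        filter_upwards [(hmem (g + g')).coeFn_toLp, (hmem g).coeFn_toLp, (hmem g').coeFn_toLp,
          Lp.coeFn_add g g', Lp.coeFn_add ((hmem g).toLp _) ((hmem g').toLp _)] with ξ h1 h2 h3 h4 h5
        rw [h1, h5, Pi.add_apply, h2, h3, h4, Pi.add_apply, mul_add]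
      map_smul' := fun c g => by
        refine Lp.ext ?_
        filter_upwards [(hmem (c • g)).coeFn_toLp, (hmem g).coeFn_toLp,
          Lp.coeFn_smul c g, Lp.coeFn_smul c ((hmem g).toLp _)] with ξ h1 h2 h3 h4
        rw [h1, RingHom.id_apply, h4, Pi.smul_apply, h2, h3, Pi.smul_apply, smul_eq_mul,
          smul_eq_mul]
        ring }
    1 fun g => by
      rw [one_mul]
      refine Lp.norm_le_norm_of_ae_le ?_
      filter_upwards [(hmem g).coeFn_toLp] with ξ h1
      simp only [LinearMap.coe_mk, AddHom.coe_mk]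
      rw [h1, norm_mul]
      exact mul_le_of_le_one_left (norm_nonneg _) (hm1 ξ)

lemma coeFn_contractionMul {m : EuclideanSpace ℝ (Fin n) → ℂ} (hm : Continuous m)
    (hm1 : ∀ ξ, ‖m ξ‖ ≤ 1) (g : Lp (α := EuclideanSpace ℝ (Fin n)) ℂ 2) :
    contractionMul m hm hm1 g =ᵐ[volume] fun ξ => m ξ * g ξ :=
  (memLp_mul_of_norm_le_one hm hm1 g).coeFn_toLp

/-- `e^{itΔ}` as a continuous linear operator on `L²`. -/
def evolutionL2CLM (t : ℝ) :
    Lp (α := EuclideanSpace ℝ (Fin n)) ℂ 2 →L[ℂ] Lp (α := EuclideanSpace ℝ (Fin n)) ℂ 2 :=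
  FourierTransform.fourierInvCLM ℂ (Lp (α := EuclideanSpace ℝ (Fin n)) ℂ 2) ∘L
    contractionMul (symbol t) (continuous_symbol t) (fun ξ => (norm_symbol t ξ).le) ∘L
    FourierTransform.fourierCLM ℂ (Lp (α := EuclideanSpace ℝ (Fin n)) ℂ 2)

lemma evolutionL2CLM_apply (t : ℝ) (f : Lp (α := EuclideanSpace ℝ (Fin n)) ℂ 2) :
    evolutionL2CLM t f = evolutionL2 t f := rfl

/-- The operator `g ↦ 𝓕⁻ ((1 + |2πξ|²)^{-s/2} g)`, which maps `L²` isometrically onto `H^s`. -/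
def sobolevLift {s : ℝ} (hs : 0 ≤ s) :
    Lp (α := EuclideanSpace ℝ (Fin n)) ℂ 2 →L[ℂ] Lp (α := EuclideanSpace ℝ (Fin n)) ℂ 2 :=
  FourierTransform.fourierInvCLM ℂ (Lp (α := EuclideanSpace ℝ (Fin n)) ℂ 2) ∘L
    contractionMul (sobolevWeight (-s)) (continuous_sobolevWeight (-s))
      (norm_sobolevWeight_neg_le hs)

lemma coeFn_fourier_sobolevLift {s : ℝ} (hs : 0 ≤ s)
    (g : Lp (α := EuclideanSpace ℝ (Fin n)) ℂ 2) :
    (𝓕 (sobolevLift hs g) : Lp ℂ 2 (volume : Measure (EuclideanSpace ℝ (Fin n)))) =ᵐ[volume]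
      fun ξ => sobolevWeight (-s) ξ * g ξ := by
  have h : (𝓕 (sobolevLift hs g) : Lp ℂ 2 (volume : Measure (EuclideanSpace ℝ (Fin n)))) = contractionMul (sobolevWeight (-s))
      (continuous_sobolevWeight (-s)) (norm_sobolevWeight_neg_le hs) g :=
    FourierTransform.fourier_fourierInv_eq _
  rw [h]
  exact coeFn_contractionMul _ _ g

lemma sobolevNorm_sobolevLift {s : ℝ} (hs : 0 ≤ s)
    (g : Lp (α := EuclideanSpace ℝ (Fin n)) ℂ 2) : sobolevNorm s (sobolevLift hs g) = ‖g‖ₑ := by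
  rw [sobolevNorm_eq_eLpNorm, Lp.enorm_def]
  refine eLpNorm_congr_ae ?_
  filter_upwards [coeFn_fourier_sobolevLift hs g] with ξ h1
  rw [h1, ← mul_assoc, sobolevWeight_mul_neg, one_mul]

lemma fourier_injective_L2 {f g : Lp (α := EuclideanSpace ℝ (Fin n)) ℂ 2}
    (h : (𝓕 f : Lp (α := EuclideanSpace ℝ (Fin n)) ℂ 2) = 𝓕 g) : f = g :=
  (Lp.fourierTransformₗᵢ (EuclideanSpace ℝ (Fin n)) ℂ).injective h

lemma sobolevLift_sobolevEmb {s : ℝ} (hs : 0 ≤ s) (f : 𝓢(EuclideanSpace ℝ (Fin n), ℂ)) :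
    sobolevLift hs (sobolevEmb s f) = f.toLp 2 := by
  refine fourier_injective_L2 (Lp.ext ?_)
  rw [SchwartzMap.toLp_fourier_eq]
  filter_upwards [coeFn_fourier_sobolevLift hs (sobolevEmb s f), coeFn_sobolevEmb s f,
    SchwartzMap.coeFn_toLp (𝓕 f) 2 volume] with ξ h1 h2 h3
  rw [h1, h2, h3, ← mul_assoc, mul_comm (sobolevWeight (-s) ξ), sobolevWeight_mul_neg, one_mul]

/-! ### Almost everywhere convergence implies the maximal estimate -/

/-- A limit at `0⁺` gives a bound near 0. Restricting to rational times leaves only countably many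
null sets where `u(·, q)` and the `L²` class disagree. -/
lemma exists_bound_of_convergesAE {f : Lp (α := EuclideanSpace ℝ (Fin n)) ℂ 2}
    (hf : ConvergesAE f) :
    ∀ᵐ x, ∃ δ > 0, ∃ M : ℝ, ∀ q : ℚ, (q : ℝ) ∈ Set.Ioo 0 δ → ‖evolutionL2 (q : ℝ) f x‖ ≤ M := by
  obtain ⟨u, hu, hlim⟩ := hf
  have hae : ∀ᵐ x, ∀ q : ℚ, (q : ℝ) ∈ Set.Ioo (0 : ℝ) 1 → u x q = evolutionL2 (q : ℝ) f x := by
    rw [ae_all_iff]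
    intro q
    by_cases hq : (q : ℝ) ∈ Set.Ioo (0 : ℝ) 1
    · filter_upwards [hu q hq] with x hx _ using hx
    · exact Eventually.of_forall fun x h => absurd h hq
  filter_upwards [hae, hlim] with x hx hxl
  have hev := hxl.norm.eventually_lt_const (lt_add_one ‖f x‖)
  obtain ⟨δ, hδ, hδ'⟩ := mem_nhdsGT_iff_exists_Ioo_subset.1 hev
  refine ⟨min δ 1, lt_min hδ one_pos, ‖f x‖ + 1, fun q hq => ?_⟩
  rw [← hx q ⟨hq.1, hq.2.trans_le (min_le_right _ _)⟩]
  exact le_of_lt (hδ' ⟨hq.1, hq.2.trans_le (min_le_left _ _)⟩)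

lemma exists_rat_lt_norm_evolution {δ : ℝ} {f : 𝓢(EuclideanSpace ℝ (Fin n), ℂ)}
    {x : EuclideanSpace ℝ (Fin n)} {r : ℝ} (hr : 0 ≤ r)
    (h : ENNReal.ofReal r < localMaximal δ f x) :
    ∃ q : ℚ, (q : ℝ) ∈ Set.Ioo 0 δ ∧ r < ‖evolution (q : ℝ) f x‖ := by
  obtain ⟨t, ht, hlt⟩ := lt_localMaximal_iff.1 h
  rw [← ofReal_norm, ENNReal.ofReal_lt_ofReal_iff_of_nonneg hr] at hlt
  have hopen : IsOpen (Set.Ioo (0 : ℝ) δ ∩ {t | r < ‖evolution t f x‖}) :=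
    isOpen_Ioo.inter (isOpen_lt continuous_const (continuous_evolution_time f x).norm)
  obtain ⟨q, hy⟩ := Rat.denseRange_cast.exists_mem_open hopen ⟨t, ht, hlt⟩
  exact ⟨q, hy.1, hy.2⟩

lemma exists_small_of_convergesAEOnSobolev {s : ℝ} (hs : 0 ≤ s) (h : ConvergesAEOnSobolev n s) :
    ∃ δ > 0, ∃ A > 0, ∀ f : 𝓢(EuclideanSpace ℝ (Fin n), ℂ), ‖sobolevEmb s f‖ ≤ A →
      volume.real ({x | 1 < localMaximal δ f x} ∩ Metric.ball 0 1) ≤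
        volume.real (Metric.ball (0 : EuclideanSpace ℝ (Fin n)) 1) / 16 := by
  set T : ℝ → Lp (α := EuclideanSpace ℝ (Fin n)) ℂ 2 →L[ℂ]
    Lp (α := EuclideanSpace ℝ (Fin n)) ℂ 2 := fun t => evolutionL2CLM t ∘L sobolevLift hs with hTdef
  have hT : ∀ g, ∀ᵐ x, ∃ δ > 0, ∃ M : ℝ, ∀ q : ℚ, (q : ℝ) ∈ Set.Ioo 0 δ → ‖T q g x‖ ≤ M := by
    intro g
    refine exists_bound_of_convergesAE (h (sobolevLift hs g) ?_)
    rw [sobolevNorm_sobolevLift]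
    exact enorm_lt_top
  have hB0 := (Metric.measure_ball_pos volume (0 : EuclideanSpace ℝ (Fin n)) one_pos).ne'
  have hBt : volume (Metric.ball (0 : EuclideanSpace ℝ (Fin n)) 1) ≠ ∞ := measure_ball_lt_top.ne
  obtain ⟨δ, hδ, A, hA, hle⟩ := exists_measure_exceedSet_le T hBt hT
    (ε := volume (Metric.ball (0 : EuclideanSpace ℝ (Fin n)) 1) / 32)
    (ENNReal.div_ne_zero.2 ⟨hB0, by simp⟩)
  refine ⟨δ, hδ, A, hA, fun f hf => ?_⟩
  have hae : ∀ᵐ x, ∀ q : ℚ, T q (sobolevEmb s f) x = evolution (q : ℝ) f x := by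
    rw [ae_all_iff]
    intro q
    have h1 : T q (sobolevEmb s f) = evolutionL2 (q : ℝ) (f.toLp 2) := by
      rw [← sobolevLift_sobolevEmb hs f]
      rfl
    rw [h1]
    exact coeFn_evolutionL2_toLp _ f
  have h2 : volume ({x | 1 < localMaximal δ f x} ∩ Metric.ball 0 1) ≤
      volume (Metric.ball (0 : EuclideanSpace ℝ (Fin n)) 1) / 32 +
        volume (Metric.ball (0 : EuclideanSpace ℝ (Fin n)) 1) / 32 := by
    refine le_trans ?_ (hle _ hf)
    rw [Measure.restrict_apply (measurableSet_exceedSet T δ 1 _)]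
    refine measure_mono_ae ?_
    filter_upwards [hae] with x hx
    rintro ⟨hx1, hx2⟩
    obtain ⟨q, hq, hlt⟩ := exists_rat_lt_norm_evolution zero_le_one
      (by rwa [ENNReal.ofReal_one])
    refine ⟨⟨q, hq, ?_⟩, hx2⟩
    rw [hx q]
    exact hlt
  have h3 := ENNReal.toReal_mono (by finiteness) h2
  rw [ENNReal.toReal_add (by finiteness) (by finiteness), ENNReal.toReal_div] at h3
  simp only [Measure.real]
  norm_num at h3 ⊢
  linarith

lemma volume_real_lt_localMaximal_le {s δ C : ℝ}
    (h : ∀ f : 𝓢(EuclideanSpace ℝ (Fin n), ℂ),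
      volume.real ({x | 1 < localMaximal δ f x} ∩ Metric.ball 0 1) ≤ C * ‖sobolevEmb s f‖ ^ 2)
    (f : 𝓢(EuclideanSpace ℝ (Fin n), ℂ)) {r : ℝ≥0} (hr : 0 < r) :
    volume.real ({x | (r : ℝ≥0∞) < localMaximal δ f x} ∩ Metric.ball 0 1) ≤
      C * (‖sobolevEmb s f‖ / r) ^ 2 := by
  have h1 := h (((r⁻¹ : ℝ≥0) : ℂ) • f)
  have h2 : ‖(((r⁻¹ : ℝ≥0) : ℝ) : ℂ)‖ₑ = (r : ℝ≥0∞)⁻¹ := by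
    rw [← ENNReal.coe_inv hr.ne', enorm_eq_nnnorm]
    simp
  have h3 : {x | 1 < localMaximal δ (((r⁻¹ : ℝ≥0) : ℂ) • f) x} =
      {x | (r : ℝ≥0∞) < localMaximal δ f x} := by
    ext x
    simp only [Set.mem_ofPred_eq]
    rw [localMaximal_smul, h2, ← ENNReal.div_eq_inv_mul, ENNReal.lt_div_iff_mul_lt
      (Or.inl (by exact_mod_cast hr.ne')) (Or.inl ENNReal.coe_ne_top), one_mul]
  rw [h3, map_smul, norm_smul, Complex.norm_real, Real.norm_of_nonneg (NNReal.coe_nonneg _),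
    NNReal.coe_inv, inv_mul_eq_div] at h1
  exact h1

/-- Restarting the flow at the times `i δ / 2` reduces `(0, 1)` to short intervals. Steps of `δ / 2`
rather than `δ` make the open intervals overlap, so no time is missed. -/
lemma localMaximal_one_subset {δ : ℝ} (hδ : 0 < δ) (f : 𝓢(EuclideanSpace ℝ (Fin n), ℂ))
    (r : ℝ≥0∞) :
    {x | r < localMaximal 1 f x} ⊆ ⋃ i ∈ Finset.range ⌈2 / δ⌉₊,
      {x | r < localMaximal δ (propagator (i * (δ / 2)) f) x} := by
  intro x hx
  obtain ⟨t, ht, hlt⟩ := lt_localMaximal_iff.1 hx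
  have hpos : 0 < t / (δ / 2) := div_pos ht.1 (by positivity)
  obtain ⟨i, hi⟩ := Nat.exists_eq_succ_of_ne_zero (Nat.ceil_pos.2 hpos).ne'
  have h1 := Nat.ceil_lt_add_one hpos.le
  have h2 := Nat.le_ceil (t / (δ / 2))
  rw [hi] at h1 h2
  push_cast at h1 h2
  rw [div_le_iff₀ (by positivity)] at h2
  have h3 : (i : ℝ) < t / (δ / 2) := by linarith
  rw [lt_div_iff₀ (by positivity)] at h3
  refine Set.mem_biUnion (x := i) ?_ (lt_localMaximal_iff.2
    ⟨t - i * (δ / 2), ⟨by linarith, by linarith⟩, ?_⟩)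
  · have h4 : (i : ℝ) < 2 / δ := by
      rw [lt_div_iff₀ hδ]
      linarith [ht.2]
    simpa using Nat.lt_ceil.2 h4
  · rwa [evolution_propagator, sub_add_cancel]

lemma maximalBounded_of_convergesAEOnSobolev {s : ℝ} (hs : 0 ≤ s)
    (h : ConvergesAEOnSobolev n s) : MaximalBounded n s := by
  obtain ⟨δ, hδ, A, hA, hsmall⟩ := exists_small_of_convergesAEOnSobolev hs h
  have hweak := volume_real_sq_le_of_small hA hsmall
  set C := 16 * volume.real (Metric.ball (0 : EuclideanSpace ℝ (Fin n)) 2) / A ^ 2 with hC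
  set K := ⌈2 / δ⌉₊ with hK
  have hC0 : 0 ≤ C := by positivity
  refine ⟨(√(K * C)).toNNReal, fun f => ?_⟩
  rw [weakL2Norm, sobolevNorm_toLp, maximalFunction_eq_localMaximal]
  refine iSup_le fun r => ?_
  rcases eq_or_lt_of_le (zero_le (a := r)) with rfl | hr
  · simp
  have hr' : (0 : ℝ) < r := hr
  have hreal : volume.real ({x | (r : ℝ≥0∞) < localMaximal 1 f x} ∩ Metric.ball 0 1) ≤
      K * C * (‖sobolevEmb s f‖ / r) ^ 2 := by
    have hsub : {x | (r : ℝ≥0∞) < localMaximal 1 f x} ∩ Metric.ball 0 1 ⊆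
        ⋃ i ∈ Finset.range K,
          ({x | (r : ℝ≥0∞) < localMaximal δ (propagator (i * (δ / 2)) f) x} ∩
            Metric.ball 0 1) := by
      rw [← Set.iUnion₂_inter]
      exact Set.inter_subset_inter_left _ (localMaximal_one_subset hδ f r)
    have hfin : volume (⋃ i ∈ Finset.range K,
        ({x | (r : ℝ≥0∞) < localMaximal δ (propagator (i * (δ / 2)) f) x} ∩
          Metric.ball (0 : EuclideanSpace ℝ (Fin n)) 1)) ≠ ∞ := by
      rw [← Set.iUnion₂_inter]
      exact ((measure_mono Set.inter_subset_right).trans_lt measure_ball_lt_top).ne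
    calc _ ≤ _ := measureReal_mono hsub hfin
      _ ≤ ∑ i ∈ Finset.range K, volume.real
          ({x | (r : ℝ≥0∞) < localMaximal δ (propagator (i * (δ / 2)) f) x} ∩
            Metric.ball (0 : EuclideanSpace ℝ (Fin n)) 1) := measureReal_biUnion_finset_le _ _
      _ ≤ ∑ i ∈ Finset.range K, C * (‖sobolevEmb s f‖ / r) ^ 2 := by
          refine Finset.sum_le_sum fun i _ => ?_
          have := volume_real_lt_localMaximal_le hweak (propagator (i * (δ / 2)) f) hr
          rwa [norm_sobolevEmb_propagator] at this
      _ = _ := by simp [mul_assoc]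
  have hmeas : volume ({x | (r : ℝ≥0∞) < localMaximal 1 f x} ∩ Metric.ball 0 1) ≤
      ENNReal.ofReal (K * C * (‖sobolevEmb s f‖ / r) ^ 2) := by
    rw [ENNReal.le_ofReal_iff_toReal_le
      ((measure_mono Set.inter_subset_right).trans_lt measure_ball_lt_top).ne (by positivity)]
    exact hreal
  rw [Measure.restrict_apply (isOpen_lt_localMaximal 1 f r).measurableSet]
  calc (r : ℝ≥0∞) * volume ({x | (r : ℝ≥0∞) < localMaximal 1 f x} ∩ Metric.ball 0 1) ^ (1 / 2 : ℝ)
      ≤ r * ENNReal.ofReal (K * C * (‖sobolevEmb s f‖ / r) ^ 2) ^ (1 / 2 : ℝ) := by gcongr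
    _ = ENNReal.ofReal (r * (√(K * C) * (‖sobolevEmb s f‖ / r))) := by
        rw [ENNReal.ofReal_rpow_of_nonneg (by positivity) (by norm_num), ← Real.sqrt_eq_rpow,
          Real.sqrt_mul (by positivity), Real.sqrt_sq (by positivity),
          ENNReal.ofReal_mul hr'.le, ENNReal.ofReal_coe_nnreal]
    _ = ((√(K * C)).toNNReal : ℝ≥0∞) * ‖sobolevEmb s f‖ₑ := by
        rw [← ofReal_norm, ← ENNReal.ofReal, ← ENNReal.ofReal_mul (by positivity)]
        congr 1
        field_simp

/-! ### The maximal estimate implies almost everywhere convergence -/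

lemma MaximalBounded.exists_volume_le {s : ℝ} (h : MaximalBounded n s) :
    ∃ C : ℝ≥0, ∀ (f : 𝓢(EuclideanSpace ℝ (Fin n), ℂ)) (r : ℝ≥0),
      (r : ℝ≥0∞) ^ 2 * volume ({x | (r : ℝ≥0∞) < maximalFunction f x} ∩ Metric.ball 0 1) ≤
        (C * ‖sobolevEmb s f‖ₑ) ^ 2 := by
  obtain ⟨C, hC⟩ := h
  refine ⟨C, fun f r => ?_⟩
  have h1 := (le_iSup (fun r : ℝ≥0 => (r : ℝ≥0∞) * volume.restrict (Metric.ball 0 1)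
    {x | (r : ℝ≥0∞) < maximalFunction f x} ^ (1 / 2 : ℝ)) r).trans (hC f)
  rw [maximalFunction_eq_localMaximal] at h1 ⊢
  rw [Measure.restrict_apply (isOpen_lt_localMaximal 1 f r).measurableSet,
    sobolevNorm_toLp] at h1
  have h2 := pow_le_pow_left' h1 2
  rw [mul_pow, ← ENNReal.rpow_natCast (_ ^ (1 / 2 : ℝ)), ← ENNReal.rpow_mul] at h2
  norm_num at h2
  exact h2

lemma volume_lt_maximalFunction_ball_le {s : ℝ} {C : ℝ≥0}
    (hC : ∀ (f : 𝓢(EuclideanSpace ℝ (Fin n), ℂ)) (r : ℝ≥0),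
      (r : ℝ≥0∞) ^ 2 * volume ({x | (r : ℝ≥0∞) < maximalFunction f x} ∩ Metric.ball 0 1) ≤
        (C * ‖sobolevEmb s f‖ₑ) ^ 2)
    (f : 𝓢(EuclideanSpace ℝ (Fin n), ℂ)) (r : ℝ≥0) (a : EuclideanSpace ℝ (Fin n)) :
    (r : ℝ≥0∞) ^ 2 * volume ({x | (r : ℝ≥0∞) < maximalFunction f x} ∩ Metric.ball a 1) ≤
      (C * ‖sobolevEmb s f‖ₑ) ^ 2 := by
  have h1 := hC (translation (-a) f) r
  rw [← ofReal_norm (sobolevEmb s (translation (-a) f)), norm_sobolevEmb_translation,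
    ofReal_norm] at h1
  rw [← measure_preimage_add_right volume a]
  convert h1 using 4
  ext x
  simp only [maximalFunction_eq_localMaximal, Set.mem_preimage, Set.mem_inter_iff,
    Set.mem_ofPred_eq, localMaximal_translation, sub_neg_eq_add, Metric.mem_ball, dist_eq_norm,
    add_sub_cancel_right, sub_zero]

/-- The weight and its reciprocal both have temperate growth, so multiplication by the weight is
onto Schwartz space, which is dense in `L²`. -/
lemma denseRange_sobolevEmb (s : ℝ) :
    DenseRange (sobolevEmb s : 𝓢(EuclideanSpace ℝ (Fin n), ℂ) → _) := by
  have hsurj : Function.Surjective ((SchwartzMap.smulLeftCLM ℂ (sobolevWeight s) ∘L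
      FourierTransform.fourierCLM ℂ 𝓢(EuclideanSpace ℝ (Fin n), ℂ)) :
        𝓢(EuclideanSpace ℝ (Fin n), ℂ) → 𝓢(EuclideanSpace ℝ (Fin n), ℂ)) := by
    intro g
    refine ⟨𝓕⁻ (SchwartzMap.smulLeftCLM ℂ (sobolevWeight (-s)) g), ?_⟩
    ext ξ
    rw [ContinuousLinearMap.comp_apply, FourierTransform.fourierCLM_apply,
      FourierTransform.fourier_fourierInv_eq,
      SchwartzMap.smulLeftCLM_apply_apply (hasTemperateGrowth_sobolevWeight s),
      SchwartzMap.smulLeftCLM_apply_apply (hasTemperateGrowth_sobolevWeight (-s)),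
      smul_smul, sobolevWeight_mul_neg, one_smul]
  exact (SchwartzMap.denseRange_toLpCLM (E := EuclideanSpace ℝ (Fin n)) (p := 2)
    ENNReal.ofNat_ne_top).comp hsurj.denseRange (SchwartzMap.toLpCLM ℂ ℂ 2 volume).continuous

lemma exists_sobolevLift_eq {s : ℝ} (hs : 0 ≤ s) {f : Lp (α := EuclideanSpace ℝ (Fin n)) ℂ 2}
    (hf : sobolevNorm s f < ∞) : ∃ g, sobolevLift hs g = f := by
  rw [sobolevNorm_eq_eLpNorm] at hf
  have hmem : MemLp (fun ξ => sobolevWeight s ξ *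
      (𝓕 f : Lp ℂ 2 (volume : Measure (EuclideanSpace ℝ (Fin n)))) ξ) 2 volume :=
    ⟨(continuous_sobolevWeight s).aestronglyMeasurable.mul (Lp.aestronglyMeasurable _), hf⟩
  refine ⟨hmem.toLp, fourier_injective_L2 (Lp.ext ?_)⟩
  filter_upwards [coeFn_fourier_sobolevLift hs hmem.toLp, hmem.coeFn_toLp] with ξ h1 h2
  rw [h1, h2, ← mul_assoc, mul_comm (sobolevWeight (-s) ξ), sobolevWeight_mul_neg, one_mul]

lemma evolutionL2_zero (f : Lp (α := EuclideanSpace ℝ (Fin n)) ℂ 2) : evolutionL2 0 f = f := by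
  have h : (memLp_symbol_mul 0 (𝓕 f)).toLp =
      (𝓕 f : Lp ℂ 2 (volume : Measure (EuclideanSpace ℝ (Fin n)))) := by
    refine Lp.ext ?_
    filter_upwards [(memLp_symbol_mul 0 (𝓕 f)).coeFn_toLp] with ξ h1
    rw [h1]
    simp [symbol]
  rw [evolutionL2, h, FourierTransform.fourierInv_fourier_eq]

/-- Continuity in time extends the bound to `t = 0`, where the limit function is later compared with
the initial data. -/
lemma norm_evolution_le_of_maximalFunction_le {f : 𝓢(EuclideanSpace ℝ (Fin n), ℂ)}
    {x : EuclideanSpace ℝ (Fin n)} {r : ℝ≥0} (h : maximalFunction f x ≤ r) {t : ℝ}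
    (ht : t ∈ Set.Ico (0 : ℝ) 1) : ‖evolution t f x‖ ≤ r := by
  have hIoo : ∀ t ∈ Set.Ioo (0 : ℝ) 1, ‖evolution t f x‖ ≤ r := by
    intro t ht
    by_contra! hcon
    refine absurd (lt_localMaximal_iff.2 ⟨t, ht, ?_⟩) (not_lt.2 h)
    rw [enorm_eq_nnnorm]
    exact_mod_cast hcon
  have hcl : closure (Set.Ioo (0 : ℝ) 1) ⊆ {t | ‖evolution t f x‖ ≤ r} :=
    closure_minimal hIoo (isClosed_le (continuous_evolution_time f x).norm continuous_const)
  rw [closure_Ioo zero_ne_one] at hcl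
  exact hcl ⟨ht.1, ht.2.le⟩

lemma tendsto_limUnder_and_continuousOn {a : ℕ → ℝ → ℂ} (ha : ∀ k, Continuous (a k))
    (h : ∀ᶠ k in atTop, ∀ t ∈ Set.Ico (0 : ℝ) 1, ‖a (k + 1) t - a k t‖ ≤ (1 / 2) ^ k) :
    (∀ t ∈ Set.Ico (0 : ℝ) 1,
      Tendsto (fun k => a k t) atTop (𝓝 (limUnder atTop fun k => a k t))) ∧
      ContinuousOn (fun t => limUnder atTop fun k => a k t) (Set.Ico 0 1) := by
  obtain ⟨K, hK⟩ := eventually_atTop.1 h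
  have hle : ∀ t ∈ Set.Ico (0 : ℝ) 1, ∀ k, dist (a (k + K) t) (a (k + 1 + K) t) ≤
      1 * (1 / 2) ^ k := by
    intro t ht k
    rw [dist_comm, dist_eq_norm, add_right_comm, one_mul]
    exact (hK (k + K) (by omega) t ht).trans
      (pow_le_pow_of_le_one (by norm_num) (by norm_num) (by omega))
  have hlim : ∀ t ∈ Set.Ico (0 : ℝ) 1,
      Tendsto (fun k => a k t) atTop (𝓝 (limUnder atTop fun k => a k t)) := by
    intro t ht
    obtain ⟨l, hl⟩ := cauchySeq_tendsto_of_complete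
      (cauchySeq_of_le_geometric (1 / 2) 1 (by norm_num) (hle t ht))
    exact tendsto_nhds_limUnder ⟨l, (tendsto_add_atTop_iff_nat K).1 hl⟩
  refine ⟨hlim, ?_⟩
  have hunif : TendstoUniformlyOn (fun k t => a (k + K) t)
      (fun t => limUnder atTop fun k => a k t) atTop (Set.Ico 0 1) := by
    rw [Metric.tendstoUniformlyOn_iff]
    intro ε hε
    have h1 : Tendsto (fun k : ℕ => 1 * (1 / 2 : ℝ) ^ k / (1 - 1 / 2)) atTop (𝓝 0) := by
      have := ((tendsto_pow_atTop_nhds_zero_of_lt_one (r := (1 / 2 : ℝ)) (by norm_num)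
        (by norm_num)).const_mul 1).div_const (1 - 1 / 2)
      simpa using this
    filter_upwards [h1.eventually_lt_const hε] with k hk t ht
    rw [dist_comm]
    exact (dist_le_of_le_geometric_of_tendsto (1 / 2) 1 (by norm_num) (hle t ht)
      ((tendsto_add_atTop_iff_nat K).2 (hlim t ht)) k).trans_lt hk
  exact hunif.continuousOn (Eventually.of_forall fun k => (ha _).continuousOn).frequently

/-- At height `2^{-k}` the exceptional set in a unit ball has measure at most `C² 4^{-k}`, which is
summable, so Borel–Cantelli applies. Countably many unit balls with dense centres reach every point.
-/
lemma ae_eventually_norm_evolution_le {s : ℝ} (h : MaximalBounded n s)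
    {ψ : ℕ → 𝓢(EuclideanSpace ℝ (Fin n), ℂ)}
    (hψ : ∀ k, ‖sobolevEmb s (ψ k)‖ ≤ (1 / 4) ^ k) :
    ∀ᵐ x, ∀ᶠ k in atTop, ∀ t ∈ Set.Ico (0 : ℝ) 1, ‖evolution t (ψ k) x‖ ≤ (1 / 2) ^ k := by
  obtain ⟨C, hC⟩ := h.exists_volume_le
  set r : ℕ → ℝ≥0 := fun k => (1 / 2) ^ k with hr
  have hball : ∀ a : EuclideanSpace ℝ (Fin n), ∀ᵐ x, ∀ᶠ k in atTop,
      x ∉ {x | (r k : ℝ≥0∞) < maximalFunction (ψ k) x} ∩ Metric.ball a 1 := by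
    intro a
    refine ae_eventually_notMem ?_
    have hk : ∀ k, volume ({x | (r k : ℝ≥0∞) < maximalFunction (ψ k) x} ∩ Metric.ball a 1) ≤
        (C : ℝ≥0∞) ^ 2 * (4⁻¹ : ℝ≥0∞) ^ k := by
      intro k
      have h1 := volume_lt_maximalFunction_ball_le hC (ψ k) (r k) a
      have h2 : ‖sobolevEmb s (ψ k)‖ₑ ≤ (4⁻¹ : ℝ≥0∞) ^ k := by
        rw [← ofReal_norm]
        refine (ENNReal.ofReal_le_ofReal (hψ k)).trans_eq ?_
        rw [ENNReal.ofReal_pow (by norm_num), one_div, ENNReal.ofReal_inv_of_pos (by norm_num),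
          ENNReal.ofReal_ofNat]
      have h3 : (r k : ℝ≥0∞) ^ 2 = (4⁻¹ : ℝ≥0∞) ^ k := by
        rw [hr, ENNReal.coe_pow, ← pow_mul, mul_comm, pow_mul, one_div,
          ENNReal.coe_inv two_ne_zero, ENNReal.coe_ofNat, ← ENNReal.inv_pow]
        norm_num
      have h4 : (4⁻¹ : ℝ≥0∞) ^ k ≠ 0 := pow_ne_zero _ (by simp)
      have h5 : (4⁻¹ : ℝ≥0∞) ^ k ≠ ∞ := ENNReal.pow_ne_top (by simp)
      rw [h3] at h1
      refine (ENNReal.mul_le_mul_iff_right h4 h5).1 (h1.trans ?_)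
      calc (C * ‖sobolevEmb s (ψ k)‖ₑ) ^ 2 ≤ (C * (4⁻¹ : ℝ≥0∞) ^ k) ^ 2 := by gcongr
        _ = _ := by ring
    refine ne_top_of_le_ne_top ?_ (ENNReal.tsum_le_tsum hk)
    rw [ENNReal.tsum_mul_left]
    exact ENNReal.mul_ne_top (by simp) (tsum_geometric_lt_top.2 (by
      rw [ENNReal.inv_lt_one]; norm_num)).ne
  have hall := ae_all_iff.2 fun i => hball (TopologicalSpace.denseSeq (EuclideanSpace ℝ (Fin n)) i)
  filter_upwards [hall] with x hx
  obtain ⟨i, hi⟩ := (TopologicalSpace.denseRange_denseSeq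
    (EuclideanSpace ℝ (Fin n))).exists_mem_open Metric.isOpen_ball
    ⟨x, Metric.mem_ball_self (x := x) one_pos⟩
  filter_upwards [hx i] with k hk t ht
  have hle : maximalFunction (ψ k) x ≤ r k := by
    by_contra! hcon
    exact hk ⟨hcon, Metric.mem_ball_comm.1 hi⟩
  have := norm_evolution_le_of_maximalFunction_le hle ht
  simpa [hr] using this

lemma convergesAEOnSobolev_of_maximalBounded {s : ℝ} (hs : 0 ≤ s) (h : MaximalBounded n s) :
    ConvergesAEOnSobolev n s := by
  intro f hf
  obtain ⟨g, rfl⟩ := exists_sobolevLift_eq hs hf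
  have happrox : ∀ k : ℕ, ∃ φ : 𝓢(EuclideanSpace ℝ (Fin n), ℂ),
      dist g (sobolevEmb s φ) < (1 / 2) * (1 / 4) ^ k := fun k =>
    (denseRange_sobolevEmb s).exists_dist_lt g (by positivity)
  choose φ hφ using happrox
  have hψ : ∀ k, ‖sobolevEmb s (φ (k + 1) - φ k)‖ ≤ (1 / 4) ^ k := by
    intro k
    rw [map_sub, ← dist_eq_norm]
    have h1 := dist_triangle_left (sobolevEmb s (φ (k + 1))) (sobolevEmb s (φ k)) g
    have h2 := hφ k
    have h3 := hφ (k + 1)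
    have h4 : (0 : ℝ) < (1 / 4) ^ k := by positivity
    rw [pow_succ] at h3
    linarith
  have hlimφ : Tendsto (fun k => sobolevEmb s (φ k)) atTop (𝓝 g) := by
    rw [tendsto_iff_dist_tendsto_zero]
    have h1 : Tendsto (fun k : ℕ => (1 / 2) * (1 / 4 : ℝ) ^ k) atTop (𝓝 0) := by
      have h2 := (tendsto_pow_atTop_nhds_zero_of_lt_one (r := (1 / 4 : ℝ)) (by norm_num)
        (by norm_num)).const_mul (1 / 2 : ℝ)
      rwa [mul_zero] at h2
    refine squeeze_zero (fun _ => dist_nonneg) (fun k => ?_) h1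
    rw [dist_comm]
    exact (hφ k).le
  -- A pointwise limit of Schwartz evolutions fixes the representatives for all `t` at once;
  -- `limUnder` takes an arbitrary value where there is no limit, which for `t ∈ [0, 1)` matters
  -- only on a null set of `x`.
  set u : EuclideanSpace ℝ (Fin n) → ℝ → ℂ := fun x t =>
    limUnder atTop fun k => evolution t (φ k) x with hu
  have hgood : ∀ᵐ x, (∀ t ∈ Set.Ico (0 : ℝ) 1,
      Tendsto (fun k => evolution t (φ k) x) atTop (𝓝 (u x t))) ∧
      ContinuousOn (u x) (Set.Ico 0 1) := by
    filter_upwards [ae_eventually_norm_evolution_le h hψ] with x hx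
    refine tendsto_limUnder_and_continuousOn (a := fun k t => evolution t (φ k) x)
      (fun k => continuous_evolution_time (φ k) x) ?_
    simpa only [evolution_sub] using hx
  have hae : ∀ t ∈ Set.Ico (0 : ℝ) 1,
      (fun x => u x t) =ᵐ[volume] evolutionL2 t (sobolevLift hs g) := by
    intro t ht
    have h1 : Tendsto (fun k => evolutionL2CLM t (sobolevLift hs (sobolevEmb s (φ k)))) atTop
        (𝓝 (evolutionL2CLM t (sobolevLift hs g))) :=
      ((evolutionL2CLM t ∘L sobolevLift hs).continuous.tendsto g).comp hlimφ
    obtain ⟨ns, hns, hlim⟩ := (tendstoInMeasure_of_tendsto_Lp h1).exists_seq_tendsto_ae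
    have h2 : ∀ᵐ x, ∀ k, evolutionL2CLM t (sobolevLift hs (sobolevEmb s (φ k))) x =
        evolution t (φ k) x := by
      rw [ae_all_iff]
      intro k
      rw [sobolevLift_sobolevEmb, evolutionL2CLM_apply]
      exact coeFn_evolutionL2_toLp t (φ k)
    filter_upwards [hgood, hlim, h2] with x hx1 hx2 hx3
    simp only [hx3] at hx2
    exact tendsto_nhds_unique ((hx1.1 t ht).comp hns.tendsto_atTop) hx2
  refine ⟨u, fun t ht => hae t ⟨ht.1.le, ht.2⟩, ?_⟩
  have h0 := hae 0 ⟨le_rfl, one_pos⟩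
  rw [evolutionL2_zero] at h0
  filter_upwards [hgood, h0] with x hx hx0
  rw [← hx0]
  exact ((hx.2 0 ⟨le_rfl, one_pos⟩).mono_left
    (nhdsWithin_mono 0 Set.Ioo_subset_Ico_self)).mono_left
    (by rw [nhdsWithin_Ioo_eq_nhdsGT one_pos])

/-! ### Sums of frequency bumps with aligned phases -/

/-- After rotating by the common phase `c`, every contributing exponential has real part at least
`cos (π/3) = 1/2`, so there is no cancellation. -/
lemma half_integral_le_norm_evolution {f : 𝓢(EuclideanSpace ℝ (Fin n), ℂ)}
    {H : EuclideanSpace ℝ (Fin n) → ℝ} (hfH : ∀ ξ, 𝓕 f ξ = (H ξ : ℂ)) (hH0 : ∀ ξ, 0 ≤ H ξ)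
    {t c : ℝ} {x : EuclideanSpace ℝ (Fin n)}
    (hphase : ∀ ξ, H ξ ≠ 0 →
      ∃ k : ℤ, |inner ℝ x ξ + 2 * Real.pi * t * ‖ξ‖ ^ 2 - c - k| ≤ 1 / 6) :
    (1 / 2) * ∫ ξ, H ξ ≤ ‖evolution t f x‖ := by
  have hHre : H = fun ξ => (𝓕 f ξ).re := by
    ext ξ
    rw [hfH, Complex.ofReal_re]
  have hHint : Integrable H := by
    rw [hHre]
    exact (𝓕 f).integrable.re
  have heq : Complex.exp (Complex.I * ((-(2 * Real.pi * c) : ℝ) : ℂ)) * evolution t f x =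
      ∫ ξ, Complex.exp (((2 * Real.pi * (inner ℝ x ξ + 2 * Real.pi * t * ‖ξ‖ ^ 2 - c) : ℝ) : ℂ) *
        Complex.I) * (H ξ : ℂ) := by
    rw [evolution, ← integral_const_mul]
    refine integral_congr_ae (Eventually.of_forall fun ξ => ?_)
    simp only [hfH, symbol]
    rw [← mul_assoc, ← mul_assoc, ← Complex.exp_add, ← Complex.exp_add]
    congr 2
    push_cast
    ring
  have hint : Integrable fun ξ =>
      Complex.exp (((2 * Real.pi * (inner ℝ x ξ + 2 * Real.pi * t * ‖ξ‖ ^ 2 - c) : ℝ) : ℂ) *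
        Complex.I) * (H ξ : ℂ) := by
    refine hHint.ofReal.bdd_mul (c := 1) (Continuous.aestronglyMeasurable (by fun_prop))
      (Eventually.of_forall fun ξ => ?_)
    rw [Complex.norm_exp_ofReal_mul_I]
  have hnorm : ‖evolution t f x‖ =
      ‖Complex.exp (Complex.I * ((-(2 * Real.pi * c) : ℝ) : ℂ)) * evolution t f x‖ := by
    rw [norm_mul, mul_comm Complex.I, Complex.norm_exp_ofReal_mul_I, one_mul]
  rw [hnorm, heq]
  refine le_trans ?_ (Complex.re_le_norm _)
  rw [← integral_const_mul, ← RCLike.re_eq_complex_re, ← integral_re hint]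
  refine integral_mono (hHint.const_mul _) hint.re fun ξ => ?_
  simp only [RCLike.re_eq_complex_re, Complex.re_mul_ofReal, Complex.exp_ofReal_mul_I_re]
  by_cases hξ : H ξ = 0
  · simp [hξ]
  obtain ⟨k, hk⟩ := hphase ξ hξ
  refine mul_le_mul_of_nonneg_right ?_ (hH0 ξ)
  rw [← Real.cos_sub_int_mul_two_pi _ k, ← Real.cos_abs, ← Real.cos_pi_div_three]
  refine Real.cos_le_cos_of_nonneg_of_le_pi (abs_nonneg _) (by linarith [Real.pi_pos]) ?_
  have h1 : 2 * Real.pi * (inner ℝ x ξ + 2 * Real.pi * t * ‖ξ‖ ^ 2 - c) - k * (2 * Real.pi) =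
      2 * Real.pi * (inner ℝ x ξ + 2 * Real.pi * t * ‖ξ‖ ^ 2 - c - k) := by ring
  rw [h1, abs_mul, abs_of_pos Real.two_pi_pos]
  nlinarith [Real.pi_pos]

lemma sobolevNorm_sq_le {s R : ℝ} (hs : 0 ≤ s) {f : 𝓢(EuclideanSpace ℝ (Fin n), ℂ)}
    {H : EuclideanSpace ℝ (Fin n) → ℝ} (hfH : ∀ ξ, 𝓕 f ξ = (H ξ : ℂ)) (hH0 : ∀ ξ, 0 ≤ H ξ)
    (hH1 : ∀ ξ, H ξ ≤ 1) (hHR : ∀ ξ, H ξ ≠ 0 → ‖ξ‖ ≤ R) :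
    sobolevNorm s (f.toLp 2) ^ 2 ≤
      ENNReal.ofReal ((1 + (2 * Real.pi * R) ^ 2) ^ s * ∫ ξ, H ξ) := by
  have hHre : H = fun ξ => (𝓕 f ξ).re := by
    ext ξ
    rw [hfH, Complex.ofReal_re]
  have hHint : Integrable H := by
    rw [hHre]
    exact (𝓕 f).integrable.re
  rw [sobolevNorm, ← ENNReal.rpow_natCast, ← ENNReal.rpow_mul, SchwartzMap.toLp_fourier_eq]
  norm_num
  rw [ENNReal.ofReal_mul (by positivity), ofReal_integral_eq_lintegral_ofReal hHint
    (Eventually.of_forall hH0), ← lintegral_const_mul' _ _ ENNReal.ofReal_ne_top]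
  refine lintegral_mono_ae ?_
  filter_upwards [SchwartzMap.coeFn_toLp (𝓕 f) 2 volume] with ξ hξ
  rw [hξ, hfH]
  by_cases h0 : H ξ = 0
  · simp [h0]
  have hn := hHR ξ h0
  refine mul_le_mul' (ENNReal.ofReal_le_ofReal ?_) ?_
  · gcongr
  · rw [← ofReal_norm, Complex.norm_real, Real.norm_of_nonneg (hH0 ξ),
      ← ENNReal.ofReal_pow (hH0 ξ)]
    exact ENNReal.ofReal_le_ofReal (by nlinarith [hH0 ξ, hH1 ξ])

/-- Test function: bumps of radius `ρ` around the points of `Λ`. Separation by `2ρ` keeps their sum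
`H ≤ 1`, so the squared norm is linear in `|Λ|`, while aligned phases make the squared height
quadratic in it. -/
lemma MaximalBounded.exists_card_mul_volume_le {s ρ : ℝ} (h : MaximalBounded n s) (hs : 0 ≤ s)
    (hρ : 0 < ρ) :
    ∃ C : ℝ, ∀ (Λ : Finset (EuclideanSpace ℝ (Fin n))) (R : ℝ)
      (S : Set (EuclideanSpace ℝ (Fin n))),
      (∀ η ∈ Λ, ∀ η' ∈ Λ, η ≠ η' → 2 * ρ ≤ dist η η') → (∀ η ∈ Λ, ‖η‖ + ρ ≤ R) →
      S ⊆ Metric.ball 0 1 →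
      (∀ x ∈ S, ∃ t ∈ Set.Ioo (0 : ℝ) 1, ∃ c : ℝ, ∀ η ∈ Λ, ∀ ζ, ‖ζ‖ < ρ →
        ∃ k : ℤ, |inner ℝ x (η + ζ) + 2 * Real.pi * t * ‖η + ζ‖ ^ 2 - c - k| ≤ 1 / 6) →
      Λ.card * volume.real S ≤ C * (1 + (2 * Real.pi * R) ^ 2) ^ s := by
  obtain ⟨C, hC⟩ := h.exists_volume_le
  let b : ContDiffBump (0 : EuclideanSpace ℝ (Fin n)) := ⟨ρ / 2, ρ, by linarith, by linarith⟩
  have hbs : HasCompactSupport fun ξ => ((b ξ : ℝ) : ℂ) :=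
    b.hasCompactSupport.comp_left Complex.ofReal_zero
  let ψ : 𝓢(EuclideanSpace ℝ (Fin n), ℂ) := hbs.toSchwartzMap
    (Complex.ofRealCLM.contDiff.comp b.contDiff)
  have hψ : ∀ ξ, ψ ξ = ((b ξ : ℝ) : ℂ) := fun ξ => rfl
  set I := ∫ ξ, b ξ with hI
  have hI0 : 0 < I := b.integral_pos
  have hbint : Integrable b := b.integrable
  refine ⟨16 * C ^ 2 / I, fun Λ R S hsep hR hS hphase => ?_⟩
  rcases Λ.eq_empty_or_nonempty with rfl | hΛ
  · simp only [Finset.card_empty, Nat.cast_zero, zero_mul]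
    positivity
  set N : ℝ := (Λ.card : ℝ) with hN
  have hN0 : 0 < N := Nat.cast_pos.2 hΛ.card_pos
  set H : EuclideanSpace ℝ (Fin n) → ℝ := fun ξ => ∑ η ∈ Λ, b (ξ - η) with hH
  set f : 𝓢(EuclideanSpace ℝ (Fin n), ℂ) := 𝓕⁻ (∑ η ∈ Λ, SchwartzMap.compSubConstCLM ℂ η ψ)
    with hf
  have hfH : ∀ ξ, 𝓕 f ξ = (H ξ : ℂ) := by
    intro ξ
    rw [hf, FourierTransform.fourier_fourierInv_eq]
    simp [hH, hψ]
  have hH0 : ∀ ξ, 0 ≤ H ξ := fun ξ => Finset.sum_nonneg fun η _ => b.nonneg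
  have hsupp : ∀ ξ η, b (ξ - η) ≠ 0 → ‖ξ - η‖ < ρ := by
    intro ξ η hne
    have h1 : ξ - η ∈ Function.support b := hne
    rw [b.support_eq] at h1
    simpa using h1
  have hHne : ∀ ξ, H ξ ≠ 0 → ∃ η ∈ Λ, ‖ξ - η‖ < ρ := by
    intro ξ hne
    obtain ⟨η, hη, hne'⟩ := Finset.exists_ne_zero_of_sum_ne_zero hne
    exact ⟨η, hη, hsupp ξ η hne'⟩
  have hH1 : ∀ ξ, H ξ ≤ 1 := by
    intro ξ
    by_cases hne : H ξ = 0
    · rw [hne]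
      exact zero_le_one
    obtain ⟨η, hη, hlt⟩ := hHne ξ hne
    rw [hH]
    simp only
    rw [Finset.sum_eq_single_of_mem η hη]
    · exact b.le_one
    · intro η' hη' hne'
      by_contra hcon
      have h1 := hsupp ξ η' hcon
      have h2 := hsep η' hη' η hη hne'
      have h3 := dist_triangle_left η' η ξ
      rw [dist_eq_norm ξ, dist_eq_norm ξ] at h3
      linarith
  have hHR : ∀ ξ, H ξ ≠ 0 → ‖ξ‖ ≤ R := by
    intro ξ hne
    obtain ⟨η, hη, hlt⟩ := hHne ξ hne
    have h1 := norm_le_norm_add_norm_sub' ξ η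
    linarith [hR η hη]
  have hHI : ∫ ξ, H ξ = N * I := by
    rw [hH, integral_finsetSum _ fun η _ => hbint.comp_sub_right η]
    simp [integral_sub_right_eq_self (fun ξ => b ξ), hN, hI]
  -- Half of the guaranteed size `N I / 2`, since the level set is defined by a strict inequality.
  set r : ℝ≥0 := (N * I / 4).toNNReal with hr
  have hrr : (r : ℝ) = N * I / 4 := Real.coe_toNNReal _ (by positivity)
  have hSr : S ⊆ {x | (r : ℝ≥0∞) < maximalFunction f x} ∩ Metric.ball 0 1 := by
    refine fun x hx => ⟨?_, hS hx⟩
    obtain ⟨t, ht, c, hc⟩ := hphase x hx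
    refine lt_localMaximal_iff.2 ⟨t, ht, ?_⟩
    have h1 := half_integral_le_norm_evolution hfH hH0 (t := t) (c := c) (x := x) (by
      intro ξ hne
      obtain ⟨η, hη, hlt⟩ := hHne ξ hne
      simpa using hc η hη (ξ - η) hlt)
    rw [enorm_eq_nnnorm, ENNReal.coe_lt_coe, ← NNReal.coe_lt_coe, hrr, coe_nnnorm]
    rw [hHI] at h1
    have : 0 < N * I := by positivity
    linarith
  have h1 := hC f r
  rw [mul_pow, ← sobolevNorm_toLp] at h1
  have h2 := sobolevNorm_sq_le hs hfH hH0 hH1 hHR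
  rw [hHI] at h2
  have h3 : (r : ℝ≥0∞) ^ 2 * volume S ≤ (C : ℝ≥0∞) ^ 2 *
      ENNReal.ofReal ((1 + (2 * Real.pi * R) ^ 2) ^ s * (N * I)) := by
    refine le_trans ?_ (h1.trans ?_)
    · gcongr
    · gcongr
  have h4 := ENNReal.toReal_mono (by finiteness) h3
  rw [ENNReal.toReal_mul, ENNReal.toReal_mul, ENNReal.toReal_pow, ENNReal.toReal_pow,
    ENNReal.coe_toReal, ENNReal.coe_toReal, ENNReal.toReal_ofReal (by positivity), hrr] at h4
  change (N * I / 4) ^ 2 * volume.real S ≤ _ at h4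
  rw [div_mul_eq_mul_div, le_div_iff₀ hI0]
  refine le_of_mul_le_mul_left ?_ (show 0 < N * I / 16 by positivity)
  calc N * I / 16 * (N * volume.real S * I) = (N * I / 4) ^ 2 * volume.real S := by ring
    _ ≤ _ := h4
    _ = _ := by ring

/-! ### A lattice of frequencies -/

/-- Among `m ^ d` consecutive integers `j` there is one for which the points `j / m ^ (i + 1)` are
simultaneously close to prescribed residues modulo one. -/
lemma exists_simultaneous_approx {m : ℕ} (hm : 0 < m) (d : ℕ) (y : ℕ → ℝ) (j₀ : ℕ) :
    ∃ j, j₀ ≤ j ∧ j < j₀ + m ^ d ∧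
      ∀ i < d, ∃ a : ℤ, |y i + j / (m : ℝ) ^ (i + 1) - a| ≤ 1 / m := by
  have hm' : (0 : ℝ) < m := by exact_mod_cast hm
  induction d with
  | zero => exact ⟨j₀, le_rfl, by simp, by simp⟩
  | succ d ih =>
    obtain ⟨j, hj0, hj1, hj⟩ := ih
    set z := y d + j / (m : ℝ) ^ (d + 1) with hz
    -- Adding `c m^d` to `j` shifts the new coordinate by `c / m`, bringing it within `1 / m` of an
    -- integer, and shifts each earlier coordinate by an integer.
    set c := ⌊(⌈z⌉ - z) * m⌋₊ with hc
    have hgap : 0 ≤ (⌈z⌉ - z) * m := mul_nonneg (by linarith [Int.le_ceil z]) hm'.le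
    have hc1 : (c : ℝ) ≤ (⌈z⌉ - z) * m := Nat.floor_le hgap
    have hc2 : (⌈z⌉ - z) * m < c + 1 := Nat.lt_floor_add_one _
    have hcm : c < m := by
      have : (c : ℝ) < m := by
        refine hc1.trans_lt ?_
        have := Int.ceil_lt_add_one z
        nlinarith
      exact_mod_cast this
    refine ⟨j + c * m ^ d, by omega, ?_, fun i hi => ?_⟩
    · have : (c + 1) * m ^ d ≤ m * m ^ d := Nat.mul_le_mul_right _ hcm
      rw [pow_succ']
      linarith
    · rcases Nat.lt_succ_iff_lt_or_eq.1 hi with hi | rfl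
      · obtain ⟨a, ha⟩ := hj i hi
        refine ⟨a + c * m ^ (d - (i + 1)), ?_⟩
        convert ha using 2
        have h1 : (m : ℝ) ^ d = m ^ (d - (i + 1)) * m ^ (i + 1) := by
          rw [← pow_add]
          congr 1
          omega
        push_cast
        rw [h1]
        field_simp
        ring
      · refine ⟨⌈z⌉, ?_⟩
        have h1 : y i + ((j + c * m ^ i : ℕ) : ℝ) / (m : ℝ) ^ (i + 1) - ⌈z⌉ =
            (c - (⌈z⌉ - z) * m) / m := by
          rw [hz]
          push_cast
          field_simp
          ring
        rw [h1, abs_div, abs_of_pos hm']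
        gcongr
        rw [abs_le]
        constructor <;> linarith

/-- The phase is nearly stationary at `R`: its derivative there is at most `4 / q`, and its
second-order coefficient `τ` is at most `1 / q²`, while `w` ranges only over a window of size `q /
M`. -/
lemma abs_longitudinal_phase_le {M P q x τ R w : ℝ} (hM : 1 ≤ M) (hP : 0 ≤ P) (hq : 0 < q)
    (hMP : M * P ≤ q) (hR : R = q ^ 2) (hτ : 0 ≤ τ) (hτR : τ * R ≤ 1)
    (hx0 : 0 ≤ x + 2 * τ * R) (hx1 : x + 2 * τ * R ≤ 4 / q) (hw : |w| ≤ P) :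
    |x * (R + w) + τ * (R + w) ^ 2 - (x * R + τ * R ^ 2)| ≤ 5 / M := by
  have hM0 : 0 < M := by linarith
  have hPq : P / q ≤ 1 / M := by
    rw [div_le_div_iff₀ hq hM0]
    linarith
  have h1 : |(x + 2 * τ * R) * w| ≤ 4 / M := by
    rw [abs_mul, abs_of_nonneg hx0]
    calc (x + 2 * τ * R) * |w| ≤ 4 / q * P := by gcongr
      _ = 4 * (P / q) := by ring
      _ ≤ 4 * (1 / M) := by gcongr
      _ = 4 / M := by ring
  have h2 : |τ * w ^ 2| ≤ 1 / M := by
    rw [abs_mul, abs_of_nonneg hτ, abs_pow]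
    have hτ' : τ ≤ 1 / q ^ 2 := by
      rw [le_div_iff₀ (by positivity), ← hR]
      exact hτR
    calc τ * |w| ^ 2 ≤ 1 / q ^ 2 * P ^ 2 := by gcongr
      _ = (P / q) * (P / q) := by ring
      _ ≤ (1 / M) * (1 / M) := by gcongr
      _ ≤ (1 / M) * 1 := by
          gcongr
          rw [div_le_one hM0]
          exact hM
      _ = 1 / M := mul_one _
  have h3 : x * (R + w) + τ * (R + w) ^ 2 - (x * R + τ * R ^ 2) =
      (x + 2 * τ * R) * w + τ * w ^ 2 := by ring
  rw [h3]
  calc _ ≤ |(x + 2 * τ * R) * w| + |τ * w ^ 2| := abs_add_le _ _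
    _ ≤ 4 / M + 1 / M := add_le_add h1 h2
    _ = 5 / M := by ring

/-- On the progression `A + D k` the quadratic term is `j k²` and the linear coefficient is within
`1 / m` of `a`. For integer `a`, `j`, `k` the subtracted part is an integer; the rest is small
because `k ≤ m / M` and `|ζ| ≤ 1 / M`. -/
lemma abs_transverse_phase_le {M m x τ A D k ζ a j : ℝ} (hM : 1 ≤ M) (hm : 0 < m)
    (hk : 0 ≤ k) (hkm : M * k ≤ m) (hx : |x| ≤ 1) (hA0 : 0 ≤ 2 * τ * A) (hA1 : 2 * τ * A ≤ 1)
    (ha : |D * (x + 2 * τ * A) - a| ≤ 1 / m) (hτ0 : 0 ≤ τ) (hτ1 : τ ≤ 1) (hj : τ * D ^ 2 = j)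
    (hD0 : 0 ≤ τ * D * k) (hD1 : τ * D * k ≤ 1) (hζ : |ζ| ≤ 1 / M) :
    |x * (A + D * k + ζ) + τ * (A + D * k + ζ) ^ 2 - (x * A + τ * A ^ 2) -
      (a * k + j * k ^ 2)| ≤ 6 / M := by
  have hM0 : 0 < M := by linarith
  have h1 : |(D * (x + 2 * τ * A) - a) * k| ≤ 1 / M := by
    rw [abs_mul, abs_of_nonneg hk]
    calc _ ≤ 1 / m * k := by gcongr
      _ ≤ 1 / M := by
        rw [one_div_mul_eq_div, div_le_div_iff₀ hm hM0]
        linarith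
  have h2 : |(x + 2 * τ * A) * ζ| ≤ 2 * (1 / M) := by
    rw [abs_mul]
    have : |x + 2 * τ * A| ≤ 2 := by
      refine (abs_add_le _ _).trans ?_
      rw [abs_of_nonneg hA0]
      linarith
    gcongr
  have h3 : |2 * (τ * D * k) * ζ| ≤ 2 * (1 / M) := by
    rw [abs_mul, abs_of_nonneg (by linarith)]
    gcongr
    linarith
  have h4 : |τ * ζ ^ 2| ≤ 1 / M := by
    rw [abs_mul, abs_of_nonneg hτ0, abs_pow]
    have : 1 / M ≤ 1 := by
      rw [div_le_one hM0]
      exact hM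
    nlinarith [abs_nonneg ζ]
  have h5 : x * (A + D * k + ζ) + τ * (A + D * k + ζ) ^ 2 - (x * A + τ * A ^ 2) -
      (a * k + j * k ^ 2) = (D * (x + 2 * τ * A) - a) * k + (x + 2 * τ * A) * ζ +
        2 * (τ * D * k) * ζ + τ * ζ ^ 2 := by
    rw [← hj]
    ring
  rw [h5]
  have h6 := abs_add_le ((D * (x + 2 * τ * A) - a) * k + (x + 2 * τ * A) * ζ +
    2 * (τ * D * k) * ζ) (τ * ζ ^ 2)
  have h7 := abs_add_le ((D * (x + 2 * τ * A) - a) * k + (x + 2 * τ * A) * ζ)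
    (2 * (τ * D * k) * ζ)
  have h8 := abs_add_le ((D * (x + 2 * τ * A) - a) * k) ((x + 2 * τ * A) * ζ)
  have h9 : 6 / M = 6 * (1 / M) := by ring
  linarith

/-- The frequency `(m^{2d+4} + l, θ + m^{2d+3} k)` with `θ_i = m^{2d+4} / (2 m^{i+2})`. -/
def latticeFreq (d m l : ℕ) (k : Fin d → ℕ) : EuclideanSpace ℝ (Fin (d + 1)) :=
  WithLp.toLp 2 (Fin.cons ((m : ℝ) ^ (2 * d + 4) + l) fun i : Fin d =>
    (m : ℝ) ^ (2 * d + 4) / (2 * (m : ℝ) ^ ((i : ℕ) + 2)) + (m : ℝ) ^ (2 * d + 3) * k i)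

@[simp]
lemma latticeFreq_zero (d m l : ℕ) (k : Fin d → ℕ) :
    latticeFreq d m l k 0 = (m : ℝ) ^ (2 * d + 4) + l := rfl

@[simp]
lemma latticeFreq_succ (d m l : ℕ) (k : Fin d → ℕ) (i : Fin d) :
    latticeFreq d m l k i.succ = (m : ℝ) ^ (2 * d + 4) / (2 * (m : ℝ) ^ ((i : ℕ) + 2)) +
      (m : ℝ) ^ (2 * d + 3) * k i := rfl

lemma inner_add_mul_norm_sq_eq_sum {d : ℕ} (x ξ : EuclideanSpace ℝ (Fin (d + 1))) (τ : ℝ) :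
    inner ℝ x ξ + τ * ‖ξ‖ ^ 2 = (x 0 * ξ 0 + τ * ξ 0 ^ 2) +
      ∑ i : Fin d, (x i.succ * ξ i.succ + τ * ξ i.succ ^ 2) := by
  rw [← Fin.sum_univ_succ (fun i => x i * ξ i + τ * ξ i ^ 2), Finset.sum_add_distrib,
    ← Finset.mul_sum, EuclideanSpace.real_norm_sq_eq, PiLp.inner_apply]
  congr 1
  exact Finset.sum_congr rfl fun i _ => by simp [mul_comm]

/-- Take `2πt = τ = j / D²` with `D = m^{2d+3}`. Near-stationarity in the first coordinate, `x₀ +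
2τR ≈ 0`, needs `x₀ < 0` and leaves a window of order `m^d` for `j`. The offsets `θ_i` contribute `j
/ m^{i+1}` to the linear coefficient of the `i`-th transverse phase, so some `j` in that window
makes all `d` coefficients nearly integral. The total error `(5 + 6d) / M` is what requires `M ≥ 36
(d + 1)`. -/
lemma exists_time_aligned {d M p : ℕ} (hM : 36 * (d + 1) ≤ M) (hp : 0 < p)
    {x : EuclideanSpace ℝ (Fin (d + 1))} (hx : ‖x‖ < 1) (hx0 : x 0 < 0) :
    ∃ t ∈ Set.Ioo (0 : ℝ) 1, ∃ c : ℝ, ∀ l < p ^ (d + 2), ∀ k : Fin d → ℕ, (∀ i, k i < p) →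
      ∀ ζ, ‖ζ‖ < 1 / (M : ℝ) → ∃ K : ℤ, |inner ℝ x (latticeFreq d (M * p) l k + ζ) +
        2 * Real.pi * t * ‖latticeFreq d (M * p) l k + ζ‖ ^ 2 - c - K| ≤ 1 / 6 := by
  set m := M * p with hm
  have hM1 : 36 ≤ M := by nlinarith
  have hMR : (1 : ℝ) ≤ M := by exact_mod_cast (by omega : 1 ≤ M)
  have hm2 : 2 ≤ m := by nlinarith
  have hmR : (2 : ℝ) ≤ m := by exact_mod_cast hm2
  have hm0 : (0 : ℝ) < m := by linarith
  set D : ℝ := (m : ℝ) ^ (2 * d + 3) with hD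
  set R : ℝ := (m : ℝ) ^ (2 * d + 4) with hR
  set q : ℝ := (m : ℝ) ^ (d + 2) with hq
  have hD0 : 0 < D := by positivity
  have hq0 : 0 < q := by positivity
  have hRD : R = m * D := by rw [hR, hD]; ring
  have hRq : R = q ^ 2 := by rw [hR, hq]; ring
  have hDq : D = q * m ^ (d + 1) := by rw [hD, hq]; ring
  have hq4 : 4 ≤ q := by
    calc (4 : ℝ) = 2 ^ 2 := by norm_num
      _ ≤ m ^ 2 := by gcongr
      _ ≤ q := pow_le_pow_right₀ (by linarith) (by omega)
  have hxi : ∀ i, |x i| ≤ 1 := fun i => (PiLp.norm_apply_le x i).trans hx.le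
  set X : ℝ := -x 0 * D / (2 * m) with hX
  have hX0 : 0 < X := by
    have : 0 < -x 0 := by linarith
    positivity
  -- `X` is the value of `j` at which `x₀ + 2τR` vanishes exactly; starting the search at its
  -- ceiling makes that derivative nonnegative. The value 0 for `i ≥ d` is never used.
  obtain ⟨j, hj0, hj1, hj⟩ := exists_simultaneous_approx (by omega : 0 < m) d
    (fun i => if h : i < d then D * x (Fin.succ ⟨i, h⟩) else 0) ⌈X⌉₊
  have hXj : X ≤ j := (Nat.le_ceil X).trans (by exact_mod_cast hj0)
  have hjX : (j : ℝ) ≤ X + 2 * m ^ d := by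
    have h1 : (j : ℝ) < ⌈X⌉₊ + (m : ℝ) ^ d := by exact_mod_cast hj1
    have h2 := Nat.ceil_lt_add_one hX0.le
    have h3 : (1 : ℝ) ≤ (m : ℝ) ^ d := one_le_pow₀ (by linarith)
    linarith
  have hjpos : (0 : ℝ) < j := hX0.trans_le hXj
  set τ : ℝ := j / D ^ 2 with hτ
  have hτ0 : 0 < τ := by positivity
  have hτD : τ * D ^ 2 = j := by rw [hτ]; field_simp
  have hτR : 2 * τ * R = 2 * m * j / D := by rw [hτ, hRD]; field_simp
  have hx0' : x 0 = -(2 * m * X / D) := by rw [hX]; field_simp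
  have hlow : 0 ≤ x 0 + 2 * τ * R := by
    rw [hx0', hτR, neg_add_eq_sub, sub_nonneg]
    gcongr
  have hupp : x 0 + 2 * τ * R ≤ 4 / q := by
    rw [hx0', hτR, neg_add_eq_sub, ← sub_div, div_le_div_iff₀ hD0 hq0, hDq]
    calc (2 * m * j - 2 * m * X) * q = 2 * m * (j - X) * q := by ring
      _ ≤ 2 * m * (2 * m ^ d) * q := by
          gcongr
          linarith
      _ = 4 * (q * m ^ (d + 1)) := by ring
  have hτR1 : τ * R ≤ 1 := by
    have h1 : -x 0 ≤ 1 := (neg_le_abs _).trans (hxi 0)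
    have h2 : 4 / q ≤ 1 := (div_le_one hq0).2 hq4
    linarith
  have hR1 : 1 ≤ R := one_le_pow₀ (by linarith)
  have hτ1 : τ ≤ 1 := by nlinarith
  set A : Fin d → ℝ := fun i => R / (2 * (m : ℝ) ^ ((i : ℕ) + 2)) with hA
  have hA0 : ∀ i, 0 ≤ 2 * τ * A i := fun i => by positivity
  have hA1 : ∀ i, 2 * τ * A i ≤ 1 := by
    intro i
    have h1 : 2 * τ * A i = τ * R / (m : ℝ) ^ ((i : ℕ) + 2) := by
      rw [hA]
      field_simp
    rw [h1]
    exact div_le_one_of_le₀ (hτR1.trans (one_le_pow₀ (by linarith))) (by positivity)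
  have ha : ∀ i : Fin d, ∃ a : ℤ, |D * (x i.succ + 2 * τ * A i) - a| ≤ 1 / m := by
    intro i
    obtain ⟨a, ha⟩ := hj i i.2
    refine ⟨a, ?_⟩
    convert ha using 2
    simp only [i.2, dif_pos, Fin.eta]
    rw [hA, hτ, hRD]
    field_simp
    ring
  choose a ha using ha
  have hπ : 0 < 2 * Real.pi := Real.two_pi_pos
  refine ⟨τ / (2 * Real.pi), ⟨by positivity, ?_⟩, (x 0 * R + τ * R ^ 2) +
    ∑ i, (x (Fin.succ i) * A i + τ * A i ^ 2), fun l hl k hk ζ hζ =>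
      ⟨∑ i, (a i * k i + j * (k i : ℤ) ^ 2), ?_⟩⟩
  · rw [div_lt_one hπ]
    linarith [Real.pi_gt_three]
  have hζi : ∀ i, |ζ i| ≤ 1 / M := fun i => (PiLp.norm_apply_le ζ i).trans hζ.le
  rw [mul_div_cancel₀ _ hπ.ne', inner_add_mul_norm_sq_eq_sum]
  simp only [PiLp.add_apply, latticeFreq_zero, latticeFreq_succ]
  push_cast
  have h0 : |x 0 * (R + (l + ζ 0)) + τ * (R + (l + ζ 0)) ^ 2 - (x 0 * R + τ * R ^ 2)| ≤
      5 / M := by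
    refine abs_longitudinal_phase_le (P := (p : ℝ) ^ (d + 2)) hMR (by positivity) hq0 ?_ hRq hτ0.le
      hτR1 hlow hupp ?_
    · rw [hq, hm, Nat.cast_mul, mul_pow]
      gcongr
      exact le_self_pow₀ hMR (by omega)
    · have h1 : (l : ℝ) + 1 ≤ (p : ℝ) ^ (d + 2) := by exact_mod_cast hl
      have h2 : 1 / (M : ℝ) ≤ 1 := (div_le_one (by linarith)).2 hMR
      calc |(l : ℝ) + ζ 0| ≤ |(l : ℝ)| + |ζ 0| := abs_add_le _ _
        _ ≤ l + 1 := by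
            rw [Nat.abs_cast]
            linarith [hζi 0]
        _ ≤ _ := h1
  have hi : ∀ i : Fin d, |x i.succ * (A i + D * k i + ζ i.succ) +
      τ * (A i + D * k i + ζ i.succ) ^ 2 - (x i.succ * A i + τ * A i ^ 2) -
        (a i * k i + j * (k i : ℝ) ^ 2)| ≤ 6 / M := by
    intro i
    have hkp : (k i : ℝ) ≤ p := by exact_mod_cast (hk i).le
    have hmp : (M : ℝ) * p = m := by rw [hm]; push_cast; rfl
    have hkm : (k i : ℝ) ≤ m := by
      rw [← hmp]
      nlinarith [Nat.cast_nonneg (α := ℝ) p]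
    refine abs_transverse_phase_le (m := m) hMR hm0 (Nat.cast_nonneg _) ?_ (hxi _) (hA0 i) (hA1 i)
      (ha i) hτ0.le hτ1 hτD (by positivity) ?_ (hζi _)
    · rw [← hmp]
      gcongr
    · calc τ * D * k i ≤ τ * D * m := by gcongr
        _ = τ * R := by rw [hRD]; ring
        _ ≤ 1 := hτR1
  have hsplit : ∀ (u v : ℝ) (U V W : Fin d → ℝ),
      u + ∑ i, U i - (v + ∑ i, V i) - ∑ i, W i = (u - v) + ∑ i, (U i - V i - W i) := by
    intro u v U V W
    rw [Finset.sum_sub_distrib, Finset.sum_sub_distrib]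
    ring
  rw [← add_assoc R] at h0
  rw [hsplit]
  have hM0 : (0 : ℝ) < M := by linarith
  calc _ ≤ 5 / (M : ℝ) + ∑ _i : Fin d, 6 / (M : ℝ) := by
        refine (abs_add_le _ _).trans (add_le_add h0 ?_)
        exact (Finset.abs_sum_le_sum_abs _ _).trans (Finset.sum_le_sum fun i _ => hi i)
    _ = (5 + 6 * d) / M := by
        rw [Finset.sum_const, Finset.card_univ, Fintype.card_fin, nsmul_eq_mul]
        ring
    _ ≤ 1 / 6 := by
        rw [div_le_div_iff₀ hM0 (by norm_num)]
        have : (36 : ℝ) * (d + 1) ≤ M := by exact_mod_cast hM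
        linarith

lemma one_le_dist_latticeFreq {d m l l' : ℕ} {k k' : Fin d → ℕ} (hm : 0 < m)
    (h : ¬ (l = l' ∧ k = k')) : 1 ≤ dist (latticeFreq d m l k) (latticeFreq d m l' k') := by
  have hcoord : ∀ i, |latticeFreq d m l k i - latticeFreq d m l' k' i| ≤
      dist (latticeFreq d m l k) (latticeFreq d m l' k') := by
    intro i
    rw [dist_eq_norm]
    exact PiLp.norm_apply_le (latticeFreq d m l k - latticeFreq d m l' k') i
  have hnat : ∀ a b : ℕ, a ≠ b → (1 : ℝ) ≤ |(a : ℝ) - b| := by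
    intro a b hab
    have h1 : 1 ≤ |(a : ℤ) - b| := Int.one_le_abs (sub_ne_zero.2 (by exact_mod_cast hab))
    exact_mod_cast h1
  by_cases hl : l = l'
  · obtain ⟨i, hi⟩ := Function.ne_iff.1 fun hk => h ⟨hl, hk⟩
    refine le_trans ?_ (hcoord i.succ)
    rw [latticeFreq_succ, latticeFreq_succ, add_sub_add_left_eq_sub, ← mul_sub, abs_mul,
      abs_of_nonneg (by positivity)]
    exact one_le_mul_of_one_le_of_one_le (one_le_pow₀ (by exact_mod_cast hm)) (hnat _ _ hi)
  · refine le_trans ?_ (hcoord 0)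
    rw [latticeFreq_zero, latticeFreq_zero, add_sub_add_left_eq_sub]
    exact hnat _ _ hl

lemma norm_latticeFreq_le {d m l : ℕ} {k : Fin d → ℕ} (hm : 0 < m) (hl : l ≤ m ^ (d + 2))
    (hk : ∀ i, k i ≤ m) : ‖latticeFreq d m l k‖ ≤ 2 * (d + 1) * (m : ℝ) ^ (2 * d + 4) := by
  have hm1 : (1 : ℝ) ≤ m := by exact_mod_cast hm
  have h0 : |latticeFreq d m l k 0| ≤ 2 * (m : ℝ) ^ (2 * d + 4) := by
    rw [latticeFreq_zero, abs_of_nonneg (by positivity)]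
    have h1 : (l : ℝ) ≤ (m : ℝ) ^ (d + 2) := by exact_mod_cast hl
    have h2 : (m : ℝ) ^ (d + 2) ≤ (m : ℝ) ^ (2 * d + 4) := pow_le_pow_right₀ hm1 (by omega)
    linarith
  have hs : ∀ i : Fin d, |latticeFreq d m l k i.succ| ≤ 2 * (m : ℝ) ^ (2 * d + 4) := by
    intro i
    rw [latticeFreq_succ, abs_of_nonneg (by positivity)]
    have h1 : (m : ℝ) ^ (2 * d + 4) / (2 * (m : ℝ) ^ ((i : ℕ) + 2)) ≤ (m : ℝ) ^ (2 * d + 4) := by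
      refine div_le_self (by positivity) ?_
      have : (1 : ℝ) ≤ (m : ℝ) ^ ((i : ℕ) + 2) := one_le_pow₀ hm1
      linarith
    have h2 : (m : ℝ) ^ (2 * d + 3) * k i ≤ (m : ℝ) ^ (2 * d + 4) := by
      rw [pow_succ _ (2 * d + 3)]
      gcongr
      exact_mod_cast hk i
    linarith
  have hsq : ‖latticeFreq d m l k‖ ^ 2 ≤ (2 * (d + 1) * (m : ℝ) ^ (2 * d + 4)) ^ 2 := by
    rw [EuclideanSpace.real_norm_sq_eq, Fin.sum_univ_succ]
    calc _ ≤ (2 * (m : ℝ) ^ (2 * d + 4)) ^ 2 +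
          ∑ _i : Fin d, (2 * (m : ℝ) ^ (2 * d + 4)) ^ 2 := by
          refine add_le_add (sq_le_sq' (abs_le.1 h0).1 (abs_le.1 h0).2)
            (Finset.sum_le_sum fun i _ => sq_le_sq' (abs_le.1 (hs i)).1 (abs_le.1 (hs i)).2)
      _ = (d + 1) * (2 * (m : ℝ) ^ (2 * d + 4)) ^ 2 := by
          rw [Finset.sum_const, Finset.card_univ, Fintype.card_fin, nsmul_eq_mul]
          ring
      _ ≤ ((d : ℝ) + 1) ^ 2 * (2 * (m : ℝ) ^ (2 * d + 4)) ^ 2 := by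
          gcongr
          nlinarith [Nat.cast_nonneg (α := ℝ) d]
      _ = _ := by ring
  exact le_of_sq_le_sq hsq (by positivity)

/-! ### The necessary condition -/

lemma exponent_le_of_pow_le_rpow {a : ℕ} {b v C : ℝ} (hv : 0 < v)
    (h : ∀ p : ℕ, 0 < p → (p : ℝ) ^ a * v ≤ C * (p : ℝ) ^ b) : (a : ℝ) ≤ b := by
  by_contra! hlt
  have h1 : Tendsto (fun p : ℕ => (p : ℝ) ^ ((a : ℝ) - b)) atTop atTop :=
    (tendsto_rpow_atTop (sub_pos.2 hlt)).comp tendsto_natCast_atTop_atTop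
  obtain ⟨p, hp0, hp⟩ := ((eventually_gt_atTop 0).and (h1.eventually_gt_atTop (C / v))).exists
  have hp' : (0 : ℝ) < p := by exact_mod_cast hp0
  have h2 := h p hp0
  rw [Real.rpow_sub hp', Real.rpow_natCast, div_lt_div_iff₀ hv (by positivity)] at hp
  linarith

/-- There are `p^{d+2}` choices of `l` and `p^d` of `k`, against frequencies of size at most a
constant times `p^{2d+4}`. Letting `p → ∞` compares `2d + 2` with `(4d + 8) s`. -/
lemma le_of_maximalBounded_of_nonneg {d : ℕ} {s : ℝ} (hs : 0 ≤ s)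
    (h : MaximalBounded (d + 1) s) : ((d : ℝ) + 1) / (2 * ((d : ℝ) + 1 + 1)) ≤ s := by
  set M : ℕ := 36 * (d + 1) with hM
  have hM36 : 36 ≤ M := by omega
  have hM0 : (36 : ℝ) ≤ M := by exact_mod_cast hM36
  obtain ⟨C, hC⟩ := h.exists_card_mul_volume_le hs (ρ := 1 / (M : ℝ)) (by positivity)
  set S : Set (EuclideanSpace ℝ (Fin (d + 1))) := Metric.ball 0 1 ∩ {x | x 0 < 0} with hS
  have hSopen : IsOpen S :=
    Metric.isOpen_ball.inter (isOpen_lt (by fun_prop) continuous_const)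
  have hSne : S.Nonempty := by
    refine ⟨EuclideanSpace.single 0 (-(1 / 2) : ℝ), ?_, ?_⟩
    · rw [mem_ball_zero_iff, PiLp.norm_single]
      norm_num
    · simp
  have hSpos : 0 < volume.real S := ENNReal.toReal_pos (hSopen.measure_pos volume hSne).ne'
    ((measure_mono Set.inter_subset_left).trans_lt measure_ball_lt_top).ne
  set W : ℝ := 2 * Real.pi * ((2 * (d + 1) + 1) * (M : ℝ) ^ (2 * d + 4)) with hW
  have hbound : ∀ p : ℕ, 0 < p → (p : ℝ) ^ (2 * d + 2) * volume.real S ≤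
      |C| * (1 + W ^ 2) ^ s * (p : ℝ) ^ ((4 * d + 8) * s) := by
    intro p hp
    have hp1 : (1 : ℝ) ≤ p := by exact_mod_cast hp
    have hm : 0 < M * p := Nat.mul_pos (by omega) hp
    have hpm : p ≤ M * p := Nat.le_mul_of_pos_left p (by omega)
    let F : Fin (p ^ (d + 2)) × (Fin d → Fin p) → EuclideanSpace ℝ (Fin (d + 1)) := fun a =>
      latticeFreq d (M * p) a.1 fun i => a.2 i
    have hsep : ∀ a a', a ≠ a' → 1 ≤ dist (F a) (F a') := by
      intro a a' hne
      refine one_le_dist_latticeFreq hm fun heq => hne ?_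
      refine Prod.ext (Fin.ext heq.1) (funext fun i => Fin.ext (congrFun heq.2 i))
    have hinj : Function.Injective F := by
      intro a a' heq
      by_contra hne
      have := hsep a a' hne
      rw [heq, dist_self] at this
      linarith
    have hcard : ((Finset.univ.map ⟨F, hinj⟩).card : ℝ) = (p : ℝ) ^ (2 * d + 2) := by
      rw [Finset.card_map, Finset.card_univ, Fintype.card_prod, Fintype.card_fin,
        Fintype.card_pi, Finset.prod_const, Finset.card_univ, Fintype.card_fin, Fintype.card_fin,
        ← pow_add]
      push_cast
      congr 1
      omega
    have hM1 : 1 / (M : ℝ) ≤ 1 / 36 := one_div_le_one_div_of_le (by norm_num) hM0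
    have h1 := hC (Finset.univ.map ⟨F, hinj⟩)
      ((2 * (d + 1) + 1) * ((M * p : ℕ) : ℝ) ^ (2 * d + 4)) S ?_ ?_ Set.inter_subset_left ?_
    · rw [hcard] at h1
      refine h1.trans ?_
      have h2 : 2 * Real.pi * ((2 * (d + 1) + 1) * ((M * p : ℕ) : ℝ) ^ (2 * d + 4)) =
          W * (p : ℝ) ^ (2 * d + 4) := by
        rw [hW]
        push_cast
        ring
      have h3 : 1 + (W * (p : ℝ) ^ (2 * d + 4)) ^ 2 ≤ (1 + W ^ 2) * (p : ℝ) ^ (4 * d + 8) := by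
        have h4 : (1 : ℝ) ≤ (p : ℝ) ^ (4 * d + 8) := one_le_pow₀ hp1
        have h5 : (W * (p : ℝ) ^ (2 * d + 4)) ^ 2 = W ^ 2 * (p : ℝ) ^ (4 * d + 8) := by ring
        rw [h5]
        linarith
      rw [h2]
      calc C * (1 + (W * (p : ℝ) ^ (2 * d + 4)) ^ 2) ^ s
          ≤ |C| * ((1 + W ^ 2) * (p : ℝ) ^ (4 * d + 8)) ^ s := by
            gcongr
            exact le_abs_self C
        _ = |C| * (1 + W ^ 2) ^ s * (p : ℝ) ^ ((4 * d + 8) * s) := by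
            rw [Real.mul_rpow (by positivity) (by positivity), ← Real.rpow_natCast (p : ℝ),
              ← Real.rpow_mul (by positivity)]
            push_cast
            ring
    · intro η hη η' hη' hne
      obtain ⟨a, -, rfl⟩ := Finset.mem_map.1 hη
      obtain ⟨a', -, rfl⟩ := Finset.mem_map.1 hη'
      have := hsep a a' fun heq => hne (by rw [heq])
      simp only [Function.Embedding.coeFn_mk]
      linarith
    · intro η hη
      obtain ⟨a, -, rfl⟩ := Finset.mem_map.1 hη
      have h2 : ‖F a‖ ≤ _ := norm_latticeFreq_le hm
        (a.1.2.le.trans (Nat.pow_le_pow_left hpm _)) fun i => (a.2 i).2.le.trans hpm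
      have h3 : (1 : ℝ) ≤ ((M * p : ℕ) : ℝ) ^ (2 * d + 4) := one_le_pow₀ (by exact_mod_cast hm)
      simp only [Function.Embedding.coeFn_mk]
      linarith
    · rintro x ⟨hx, hx0⟩
      obtain ⟨t, ht, c, hc⟩ := exists_time_aligned (M := M) le_rfl hp (mem_ball_zero_iff.1 hx) hx0
      refine ⟨t, ht, c, fun η hη ζ hζ => ?_⟩
      obtain ⟨a, -, rfl⟩ := Finset.mem_map.1 hη
      exact hc a.1 a.1.2 (fun i => a.2 i) (fun i => (a.2 i).2) ζ hζ
  have h1 := exponent_le_of_pow_le_rpow hSpos hbound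
  push_cast at h1
  rw [div_le_iff₀ (by positivity)]
  linarith

lemma MaximalBounded.mono {n : ℕ} {s s' : ℝ} (hss : s ≤ s') (h : MaximalBounded n s) :
    MaximalBounded n s' := by
  obtain ⟨C, hC⟩ := h
  refine ⟨C, fun f => (hC f).trans ?_⟩
  gcongr
  exact sobolevNorm_mono hss _

lemma ConvergesAEOnSobolev.mono {n : ℕ} {s s' : ℝ} (hss : s ≤ s')
    (h : ConvergesAEOnSobolev n s) : ConvergesAEOnSobolev n s' :=
  fun f hf => h f ((sobolevNorm_mono hss f).trans_lt hf)

/-- The bound for `max s 0` is positive, so the maximum cannot be attained by 0 and must be `s`. -/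
lemma le_of_maximalBounded {n : ℕ} (hn : 1 ≤ n) {s : ℝ} (h : MaximalBounded n s) :
    (n : ℝ) / (2 * ((n : ℝ) + 1)) ≤ s := by
  obtain ⟨d, rfl⟩ := Nat.exists_eq_add_of_le' hn
  have h1 := le_of_maximalBounded_of_nonneg (le_max_right s 0) (h.mono (le_max_left s 0))
  push_cast
  have h2 : 0 < ((d : ℝ) + 1) / (2 * ((d : ℝ) + 1 + 1)) := by positivity
  rcases le_max_iff.1 h1 with h3 | h3
  · exact h3
  · linarith

lemma le_of_convergesAEOnSobolev {n : ℕ} (hn : 1 ≤ n) {s : ℝ} (h : ConvergesAEOnSobolev n s) :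
    (n : ℝ) / (2 * ((n : ℝ) + 1)) ≤ s := by
  have h1 := le_of_maximalBounded hn
    (maximalBounded_of_convergesAEOnSobolev (le_max_right s 0) (h.mono (le_max_left s 0)))
  have hn' : (0 : ℝ) < n := by exact_mod_cast hn
  have h2 : 0 < (n : ℝ) / (2 * ((n : ℝ) + 1)) := by positivity
  rcases le_max_iff.1 h1 with h3 | h3
  · exact h3
  · linarith

end SchrodingerMaximal

end

theorem mainTheorem3 (n : ℕ) (hn : 1 ≤ n) (s : ℝ) :
    (SchrodingerMaximal.ConvergesAEOnSobolev n s → (n : ℝ) / (2 * ((n : ℝ) + 1)) ≤ s) ∧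
    (SchrodingerMaximal.MaximalBounded n s → (n : ℝ) / (2 * ((n : ℝ) + 1)) ≤ s) ∧
    (SchrodingerMaximal.ConvergesAEOnSobolev n s ↔ SchrodingerMaximal.MaximalBounded n s) := by
  -- Each property already forces `s` above a nonnegative threshold, which supplies the `0 ≤ s`
  -- needed for both implications; for negative `s` both properties fail.
  have h0 : (0 : ℝ) ≤ (n : ℝ) / (2 * ((n : ℝ) + 1)) := by positivity
  exact ⟨SchrodingerMaximal.le_of_convergesAEOnSobolev hn,
    SchrodingerMaximal.le_of_maximalBounded hn,
    fun h => SchrodingerMaximal.maximalBounded_of_convergesAEOnSobolev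
      (h0.trans (SchrodingerMaximal.le_of_convergesAEOnSobolev hn h)) h,
    fun h => SchrodingerMaximal.convergesAEOnSobolev_of_maximalBounded
      (h0.trans (SchrodingerMaximal.le_of_maximalBounded hn h)) h⟩
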